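/- **Theorem (Parametrization of minimizers).** Let $m,n\ge 1$, $q=\min\{m,n\}$, $1\le k\le q$, and let $F\in\mathcal M_{m,n}(\mathbb C)$ be a complex $m\times n$ matrix of rank $r$ with singular values $s_1(F)\ge\dots\ge s_q(F)\ge 0$. Let $\Phi$ be a symmetric gauge function on $\mathbb R^q$, i.e. a norm with $\Phi(x_1,\dots,x_q)=\Phi(|x_{\sigma(1)}|,\dots,|x_{\sigma(q)}|)$ for all $x$ and all permutations $\sigma$, and suppose that $\Phi$ is strictly convex, i.e. $\Phi(\lambda x+(1-\lambda)y)<1$ whenever $x\ne y$, $\Phi(x)=\Phi(y)=1$ and $0<\lambda<1$. Put $\|A\|_\Phi=\Phi(s_1(A),\dots,s_q(A))$ for $A\in\mathcal M_{m,n}(\mathbb C)$. A matrix $X$ is a partial isometry if $\|Xf\|=\|f\|$ for all $f\in\ker(X)^\perp$ (Euclidean norms); let $\mathcal I_{m,n}^k$ be the set of $m\times n$ complex partial isometries of rank $k$. By a minimizer we mean an $X\in\mathcal I_{m,n}^k$ with $\|F-X\|_\Phi=\min\{\|F-Y\|_\Phi : Y\in\mathcal I_{m,n}^k\}$. A singular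 value decomposition (SVD) of $F$ is a factorization $F=V\Sigma W^*$ with $V\in\mathcal M_{m,m}(\mathbb C)$ and $W\in\mathcal M_{n,n}(\mathbb C)$ unitary and $\Sigma$ the $m\times n$ matrix with main diagonal $s_1(F),\dots,s_q(F)$ and zeros elsewhere. 1. If $k<r$, then there is a unique minimizer if and only if $s_k(F)\neq s_{k+1}(F)$. If $s_k(F)=s_{k+1}(F)$, there are infinitely many minimizers. In that case, set $\ell_k=\#\{j: s_j(F)>s_k(F)\}$ and $e_k=\#\{j: s_j(F)=s_k(F)\}$ (with $1\le j\le q$). For every SVD $F=V\Sigma W^*$, the map $$P\longmapsto V\begin{bmatrix} I_{\ell_k}&0&0\\0&P&0\\0&0&0_{m-\ell_k-e_k,\,n-\ell_k-e_k}\end{bmatrix}W^*$$ is a bijection from the set of orthogonal projections $P\in\mathcal M_{e_k,e_k}(\mathbb C)$ of rank $k-\ell_k$ onto the set of minimizers. 2. If $k=r$, then the unique minimizer is the partial isometry $U$ of the canonical polar decomposition $F=U|F|$, where $|F|=(F^*F)^{1/2}$ and $U$ is a partial isometry with $\ker U=\ker F$. 3. If $r<k\le q$, there are infinitely many minimizers.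 For every SVD $F=V\Sigma W^*$, the map $$S\longmapsto V\begin{bmatrix} I_r&0\\0&S\end{bmatrix}W^*$$ is a bijection from the set of partial isometries $S\in\mathcal M_{m-r,n-r}(\mathbb C)$ of rank $k-r$ onto the set of minimizers. -/

import Mathlib

open scoped Matrix

noncomputable section

namespace PartialIsometryApprox

/-- A norm `Φ` on `ℝ^q` (a seminorm that vanishes only at `0`) which is a symmetric gauge
function: invariant under taking absolute values of the coordinates and permuting them. -/
structure IsSymmetricGauge {q : ℕ} (Φ : Seminorm ℝ (Fin q → ℝ)) : Prop where
  eq_zero_of_map_eq_zero : ∀ x, Φ x = 0 → x = 0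
  map_abs_perm : ∀ (x : Fin q → ℝ) (σ : Equiv.Perm (Fin q)), Φ x = Φ (fun i => |x (σ i)|)

/-- Strict convexity of a norm `Φ` on `ℝ^q`. -/
def IsStrictlyConvex {q : ℕ} (Φ : Seminorm ℝ (Fin q → ℝ)) : Prop :=
  ∀ x y : Fin q → ℝ, x ≠ y → Φ x = 1 → Φ y = 1 →
    ∀ t : ℝ, 0 < t → t < 1 → Φ (t • x + (1 - t) • y) < 1

/-- The `j`-th singular value `s_j(F)`, `j = 1, 2, …`, in nonincreasing order. Mathlib counts
singular values from `0`, hence the shift. The value at `j = 0` is never used. -/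
def singVal {m n : ℕ} (F : Matrix (Fin m) (Fin n) ℂ) (j : ℕ) : ℝ :=
  (Matrix.toEuclideanLin F).singularValues (j - 1)

/-- The unitarily invariant norm `‖F‖_Φ = Φ(s_1(F), …, s_q(F))`, `q = min m n`. -/
def gaugeNorm {m n : ℕ} (Φ : Seminorm ℝ (Fin (min m n) → ℝ)) (F : Matrix (Fin m) (Fin n) ℂ) : ℝ :=
  Φ (fun i => singVal F (i.val + 1))

/-- `X` is isometric on the orthogonal complement of its kernel. -/
def IsPartialIsometry {m n : ℕ} (X : Matrix (Fin m) (Fin n) ℂ) : Prop :=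
  ∀ f ∈ (LinearMap.ker (Matrix.toEuclideanLin X))ᗮ, ‖Matrix.toEuclideanLin X f‖ = ‖f‖

/-- The set of `m × n` partial isometries of rank `k`. -/
def partialIsometries (m n k : ℕ) : Set (Matrix (Fin m) (Fin n) ℂ) :=
  {X | IsPartialIsometry X ∧ X.rank = k}

/-- The minimizers of `X ↦ ‖F - X‖_Φ` among the partial isometries of rank `k`. -/
def minimizers {m n : ℕ} (Φ : Seminorm ℝ (Fin (min m n) → ℝ)) (k : ℕ)
    (F : Matrix (Fin m) (Fin n) ℂ) : Set (Matrix (Fin m) (Fin n) ℂ) :=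
  {X | X ∈ partialIsometries m n k ∧
    ∀ Y ∈ partialIsometries m n k, gaugeNorm Φ (F - X) ≤ gaugeNorm Φ (F - Y)}

/-- The `m × n` matrix with the singular values of `F` on its main diagonal, in nonincreasing
order, and zeros elsewhere. -/
def sigma {m n : ℕ} (F : Matrix (Fin m) (Fin n) ℂ) : Matrix (Fin m) (Fin n) ℂ :=
  Matrix.of fun i j => if i.val = j.val then (singVal F (i.val + 1) : ℂ) else 0

/-- `F = V Σ W*` is a singular value decomposition. -/
def IsSVD {m n : ℕ} (F : Matrix (Fin m) (Fin n) ℂ) (V : Matrix (Fin m) (Fin m) ℂ)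
    (W : Matrix (Fin n) (Fin n) ℂ) : Prop :=
  V ∈ Matrix.unitaryGroup (Fin m) ℂ ∧ W ∈ Matrix.unitaryGroup (Fin n) ℂ ∧
    F = V * sigma F * Wᴴ

open scoped MatrixOrder in
/-- `|F| = (F* F)^{1/2}`. -/
def matAbs {m n : ℕ} (F : Matrix (Fin m) (Fin n) ℂ) : Matrix (Fin n) (Fin n) ℂ :=
  CFC.sqrt (Fᴴ * F)

/-- `F = U |F|` is the canonical polar decomposition of `F`: `U` is a partial isometry with the
same kernel as `F`. -/
def IsCanonicalPolar {m n : ℕ} (F U : Matrix (Fin m) (Fin n) ℂ) : Prop :=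
  IsPartialIsometry U ∧
    LinearMap.ker (Matrix.toEuclideanLin U) = LinearMap.ker (Matrix.toEuclideanLin F) ∧
    F = U * matAbs F

/-- The `m × n` block diagonal matrix `diag(I_l, A, 0)`, where `A` is `a × b`
(meant for `l + a ≤ m` and `l + b ≤ n`). -/
def blockDiag (m n l : ℕ) {a b : ℕ} (A : Matrix (Fin a) (Fin b) ℂ) :
    Matrix (Fin m) (Fin n) ℂ :=
  Matrix.of fun i j =>
    if h : (l ≤ i.val ∧ i.val < l + a) ∧ (l ≤ j.val ∧ j.val < l + b) then
      A ⟨i.val - l, by omega⟩ ⟨j.val - l, by omega⟩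
    else if i.val = j.val ∧ i.val < l then 1 else 0

/-- `ℓ_k`: the number of singular values (among `s_1, …, s_q`) strictly larger than `s_k(F)`. -/
def numGreater {m n : ℕ} (F : Matrix (Fin m) (Fin n) ℂ) (k : ℕ) : ℕ :=
  ((Finset.Icc 1 (min m n)).filter fun j => singVal F k < singVal F j).card

/-- `e_k`: the number of singular values (among `s_1, …, s_q`) equal to `s_k(F)`. -/
def numEqual {m n : ℕ} (F : Matrix (Fin m) (Fin n) ℂ) (k : ℕ) : ℕ :=
  ((Finset.Icc 1 (min m n)).filter fun j => singVal F j = singVal F k).card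

end PartialIsometryApprox

end

noncomputable section

/-! Write `q = min m n`. All partial isometries `X` of rank `k` have the singular values `1` (`k`
times) and `0`, so `s(F) - s(X)` is one fixed vector, `gapVector F k`. By Mirsky's inequality,
`sum_abs_singVal_sub_le`, it is weakly majorized by `s(F - X)`. That inequality is `lidskii` applied
to Hermitian dilations, whose eigenvalues are the singular values, their negatives and zeros. A
weakly majorized vector lies in the convex hull of the signed permutations of the majorant
(`mem_convexHull_signedPerms`), and there a strictly convex gauge is strictly smaller except at the
signed permutations themselves (`gauge_le_of_majorized`). Hence `Φ (gapVector F k)` is a lower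
bound. It is attained by every `X` sharing a singular value decomposition with `F` (`IsAligned`).

Equality makes `gapVector F k` a signed permutation of `s(F - X)`, so the two have the same
Euclidean norm. This carries the problem over to the Frobenius norm whatever `Φ` is: expanding
squares, a minimizer satisfies `Re tr(F* X) = s_1 + … + s_k`.

The equality case is analysed in SVD coordinates, `Y = V* X W`. Rows and columns of `Y` have norm at
most `1`, and `Re Y_ii = d_i - δ_i`, where `d_i` is the mean of the squared norms of the `i`-th row
and column and `2 δ_i` is the squared distance between the `i`-th columns of `Y Y*` and `Y`. A
linear programming argument, `extremal_weights`, then gives `structure_of_re_trace_eq`: `Y` is the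
identity where `s_i > s_k`, vanishes where `s_i < s_k`, and agrees with `Y Y*` in the columns with
`s_i > 0`. If `s_k > 0`, the remaining block is therefore an orthogonal projection; if `s_k = 0`, it
is only known to be a partial isometry. Conversely, any such block can be diagonalized by unitaries
that leave `Σ` unchanged, so these matrices are aligned with `F`. When `s_k > s_{k+1}`, in
particular when `k = r`, the projection has full rank and the minimizer is unique. -/

namespace PartialIsometryApprox

/-! ### Calculus of rectangular diagonal matrices -/

/-- The `m × n` matrix with main diagonal `d 0, d 1, …` and zeros elsewhere. -/
def rectDiag (m n : ℕ) (d : ℕ → ℂ) : Matrix (Fin m) (Fin n) ℂ :=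
  Matrix.of fun i j => if i.val = j.val then d i.val else 0

lemma rectDiag_apply {m n : ℕ} (d : ℕ → ℂ) (i : Fin m) (j : Fin n) :
    rectDiag m n d i j = if i.val = j.val then d i.val else 0 := rfl

lemma rectDiag_congr {m n : ℕ} {d d' : ℕ → ℂ} (h : ∀ i, i < m → i < n → d i = d' i) :
    rectDiag m n d = rectDiag m n d' := by
  ext i j
  simp only [rectDiag_apply]
  split_ifs with hij
  · exact h _ i.2 (hij ▸ j.2)
  · rfl

lemma rectDiag_mul {m n p : ℕ} (d d' : ℕ → ℂ) :
    rectDiag m n d * rectDiag n p d' =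
      rectDiag m p fun i => if i < n then d i * d' i else 0 := by
  ext i j
  simp only [Matrix.mul_apply, rectDiag_apply]
  by_cases hi : i.val < n
  · rw [Finset.sum_eq_single (⟨i.val, hi⟩ : Fin n)]
    · simp [hi]
    · intro b _ hb
      rw [if_neg (fun h => hb (Fin.ext h.symm)), zero_mul]
    · simp
  · rw [Finset.sum_eq_zero]
    · simp [hi]
    · intro b _
      rw [if_neg (fun h => hi (by omega)), zero_mul]

lemma rectDiag_conjTranspose {m n : ℕ} (d : ℕ → ℂ) :
    (rectDiag m n d)ᴴ = rectDiag n m fun i => star (d i) := by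
  ext i j
  simp only [Matrix.conjTranspose_apply, rectDiag_apply]
  by_cases h : i.val = j.val
  · simp [h]
  · simp [h, Ne.symm h]

lemma rectDiag_self {m : ℕ} (d : ℕ → ℂ) :
    rectDiag m m d = Matrix.diagonal fun i : Fin m => d i.val := by
  ext i j
  simp [rectDiag_apply, Matrix.diagonal_apply, Fin.ext_iff]

lemma rectDiag_one {m : ℕ} : rectDiag m m (fun _ => 1) = 1 := by
  rw [rectDiag_self, ← Matrix.diagonal_one]

lemma rectDiag_add {m n : ℕ} (d d' : ℕ → ℂ) :
    rectDiag m n d + rectDiag m n d' = rectDiag m n fun i => d i + d' i := by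
  ext i j
  simp only [Matrix.add_apply, rectDiag_apply]
  split_ifs <;> simp

lemma rectDiag_sub {m n : ℕ} (d d' : ℕ → ℂ) :
    rectDiag m n d - rectDiag m n d' = rectDiag m n fun i => d i - d' i := by
  ext i j
  simp only [Matrix.sub_apply, rectDiag_apply]
  split_ifs <;> simp

lemma rectDiag_neg {m n : ℕ} (d : ℕ → ℂ) :
    -rectDiag m n d = rectDiag m n fun i => -d i := by
  ext i j
  simp only [Matrix.neg_apply, rectDiag_apply]
  split_ifs <;> simp

lemma rectDiag_zero {m n : ℕ} : rectDiag m n (fun _ => 0) = 0 := by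
  ext i j
  simp [rectDiag_apply]

/-! ### Eigenvalue inequalities: Weyl and Lidskii -/

section Unitary

variable {ι : Type*} [Fintype ι] [DecidableEq ι]

lemma unitary_conjTranspose_mul_self {U : Matrix ι ι ℂ} (hU : U ∈ Matrix.unitaryGroup ι ℂ) :
    Uᴴ * U = 1 := Matrix.mem_unitaryGroup_iff'.1 hU

lemma unitary_mul_conjTranspose_self {U : Matrix ι ι ℂ} (hU : U ∈ Matrix.unitaryGroup ι ℂ) :
    U * Uᴴ = 1 := Matrix.mem_unitaryGroup_iff.1 hU

lemma unitary_of_conjTranspose_mul_self {U : Matrix ι ι ℂ} (hU : Uᴴ * U = 1) :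
    U ∈ Matrix.unitaryGroup ι ℂ := Matrix.mem_unitaryGroup_iff'.2 hU

/-- The unitary matrix whose columns form a given orthonormal basis. -/
def onbMatrix (b : OrthonormalBasis ι ℂ (EuclideanSpace ℂ ι)) : Matrix ι ι ℂ :=
  Matrix.of fun i j => b j i

lemma onbMatrix_mem (b : OrthonormalBasis ι ℂ (EuclideanSpace ℂ ι)) :
    onbMatrix b ∈ Matrix.unitaryGroup ι ℂ := by
  have h : onbMatrix b = (EuclideanSpace.basisFun ι ℂ).toBasis.toMatrix b := by
    ext i j
    simp [onbMatrix, Module.Basis.toMatrix_apply]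
  rw [h]
  exact (EuclideanSpace.basisFun ι ℂ).toMatrix_orthonormalBasis_mem_unitary b

/-- A Hermitian matrix is unitarily diagonalizable, with the eigenvalues nonincreasing along a
prescribed enumeration of the index set. -/
lemma exists_sorted_diagonalization {N : ℕ} (e : Fin N ≃ ι) {A : Matrix ι ι ℂ}
    (hA : A.IsHermitian) :
    ∃ U ∈ Matrix.unitaryGroup ι ℂ, ∃ d : ι → ℝ, Antitone (d ∘ e) ∧
      A = U * Matrix.diagonal (fun i => (d i : ℂ)) * Uᴴ := by
  have hT := Matrix.isSymmetric_toEuclideanLin_iff.mpr hA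
  have hN : Module.finrank ℂ (EuclideanSpace ℂ ι) = N := by
    rw [finrank_euclideanSpace, ← Fintype.card_congr e, Fintype.card_fin]
  set b := (hT.eigenvectorBasis hN).reindex e with hb
  refine ⟨onbMatrix b, onbMatrix_mem b, hT.eigenvalues hN ∘ e.symm, ?_, ?_⟩
  · intro x y hxy
    simpa using hT.eigenvalues_antitone hN hxy
  · have h : A * onbMatrix b =
        onbMatrix b * Matrix.diagonal (fun i => ((hT.eigenvalues hN (e.symm i) : ℝ) : ℂ)) := by
      ext i j
      have h1 := hT.apply_eigenvectorBasis hN (e.symm j)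
      have h2 := congrArg (fun v : EuclideanSpace ℂ ι => v i) h1
      rw [Matrix.mul_diagonal]
      simp only [Matrix.toLpLin_apply, PiLp.smul_apply, smul_eq_mul, Matrix.mulVec,
        dotProduct] at h2
      simp only [Matrix.mul_apply, onbMatrix, Matrix.of_apply, hb, OrthonormalBasis.reindex_apply]
      rw [h2, mul_comm]
      rfl
    simp only [Function.comp_apply]
    rw [← h, Matrix.mul_assoc, unitary_mul_conjTranspose_self (onbMatrix_mem b), Matrix.mul_one]

/-- The quadratic form of a matrix in diagonalized form. -/
lemma re_quadForm_diagonalized {U A : Matrix ι ι ℂ} {d : ι → ℝ}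
    (hA : A = U * Matrix.diagonal (fun i => (d i : ℂ)) * Uᴴ) (x : ι → ℂ) :
    (star x ⬝ᵥ (A *ᵥ x)).re = ∑ i, d i * ‖(Uᴴ *ᵥ x) i‖ ^ 2 := by
  have : star x ⬝ᵥ (A *ᵥ x) = ∑ i, ((d i * ‖(Uᴴ *ᵥ x) i‖ ^ 2 : ℝ) : ℂ) := by
    rw [hA, ← Matrix.mulVec_mulVec, ← Matrix.mulVec_mulVec, Matrix.dotProduct_mulVec]
    have : star x ᵥ* U = star (Uᴴ *ᵥ x) := by
      rw [Matrix.star_mulVec, Matrix.conjTranspose_conjTranspose]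
    rw [this]
    simp only [dotProduct, Matrix.mulVec_diagonal, Pi.star_apply]
    refine Finset.sum_congr rfl fun i _ => ?_
    have h := Complex.conj_mul' ((Uᴴ *ᵥ x) i)
    push_cast
    rw [← h, starRingEnd_apply]
    ring
  rw [this, ← Complex.ofReal_sum, Complex.ofReal_re]

open scoped ComplexOrder in
/-- Weyl's monotonicity principle. -/
lemma weyl_monotone {N : ℕ} (e : Fin N ≃ ι) {A C U U' : Matrix ι ι ℂ} {a c : ι → ℝ}
    (hU : U ∈ Matrix.unitaryGroup ι ℂ) (hU' : U' ∈ Matrix.unitaryGroup ι ℂ)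
    (ha : Antitone (a ∘ e)) (hc : Antitone (c ∘ e))
    (hA : A = U * Matrix.diagonal (fun i => (a i : ℂ)) * Uᴴ)
    (hC : C = U' * Matrix.diagonal (fun i => (c i : ℂ)) * U'ᴴ)
    (h : ∀ x : ι → ℂ, (star x ⬝ᵥ (A *ᵥ x)).re ≤ (star x ⬝ᵥ (C *ᵥ x)).re) (i : ι) :
    a i ≤ c i := by
  -- A vector in `ker L` lies both in the span of the eigenvectors of `A` up to position `i` and in
  -- that of the eigenvectors of `C` from position `i` on. There is one conditions fewer than the
  -- dimension, so such a vector exists and its two Rayleigh quotients compare `a i` with `c i`.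
  let L : (ι → ℂ) →ₗ[ℂ] ({j // j ≠ i} → ℂ) := LinearMap.pi fun j =>
    if e.symm i < e.symm j.1 then (LinearMap.proj j.1).comp (Matrix.mulVecLin Uᴴ)
    else (LinearMap.proj j.1).comp (Matrix.mulVecLin U'ᴴ)
  have hker : LinearMap.ker L ≠ ⊥ := by
    apply LinearMap.ker_ne_bot_of_finrank_lt
    rw [Module.finrank_fintype_fun_eq_card, Module.finrank_fintype_fun_eq_card]
    exact Fintype.card_subtype_lt (x := i) (by simp)
  obtain ⟨x, hx, hx0⟩ := Submodule.exists_mem_ne_zero_of_ne_bot hker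
  have hL : ∀ j : {j // j ≠ i}, L x j = 0 := fun j => by
    rw [LinearMap.mem_ker.1 hx]; rfl
  have h1 : ∀ j, e.symm i < e.symm j → (Uᴴ *ᵥ x) j = 0 := fun j hj => by
    have := hL ⟨j, fun h => by simp [h] at hj⟩
    simpa [L, hj] using this
  have h2 : ∀ j, e.symm j < e.symm i → (U'ᴴ *ᵥ x) j = 0 := fun j hj => by
    have := hL ⟨j, fun h => by simp [h] at hj⟩
    simpa [L, hj.not_gt] using this
  have norm_eq : ∀ {V : Matrix ι ι ℂ}, V ∈ Matrix.unitaryGroup ι ℂ →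
      (star x ⬝ᵥ x).re = ∑ j, ‖(Vᴴ *ᵥ x) j‖ ^ 2 := fun {V} hV => by
    have := re_quadForm_diagonalized (U := V) (A := 1) (d := fun _ => 1) (by
      simp [unitary_mul_conjTranspose_self hV]) x
    simpa using this
  have hpos : 0 < (star x ⬝ᵥ x).re := by
    have h3 := Matrix.dotProduct_star_self_pos_iff.2 hx0
    exact (Complex.pos_iff.1 h3).1
  have hle1 : a i * (star x ⬝ᵥ x).re ≤ (star x ⬝ᵥ (A *ᵥ x)).re := by
    rw [norm_eq hU, re_quadForm_diagonalized hA, Finset.mul_sum]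
    refine Finset.sum_le_sum fun j _ => ?_
    rcases lt_or_ge (e.symm i) (e.symm j) with hj | hj
    · simp [h1 j hj]
    · have := ha hj
      simp only [Function.comp_apply, Equiv.apply_symm_apply] at this
      gcongr
  have hle2 : (star x ⬝ᵥ (C *ᵥ x)).re ≤ c i * (star x ⬝ᵥ x).re := by
    rw [norm_eq hU', re_quadForm_diagonalized hC, Finset.mul_sum]
    refine Finset.sum_le_sum fun j _ => ?_
    rcases lt_or_ge (e.symm j) (e.symm i) with hj | hj
    · simp [h2 j hj]
    · have := hc hj
      simp only [Function.comp_apply, Equiv.apply_symm_apply] at this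
      gcongr
  exact le_of_mul_le_mul_right (hle1.trans ((h x).trans hle2)) hpos

lemma trace_unitary_conj {U M : Matrix ι ι ℂ} (hU : U ∈ Matrix.unitaryGroup ι ℂ) :
    (U * M * Uᴴ).trace = M.trace := by
  rw [Matrix.trace_mul_comm, ← Matrix.mul_assoc, unitary_conjTranspose_mul_self hU, Matrix.one_mul]

lemma isHermitian_diagonalized (U : Matrix ι ι ℂ) (d : ι → ℝ) :
    (U * Matrix.diagonal (fun i => (d i : ℂ)) * Uᴴ).IsHermitian :=
  Matrix.isHermitian_mul_mul_conjTranspose U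
    (Matrix.isHermitian_diagonal_of_self_adjoint _ (by
      ext i; simp))

/-- Lidskii's inequality, in the form of Li and Mathias. -/
lemma lidskii {N : ℕ} (e : Fin N ≃ ι) {U U' U'' : Matrix ι ι ℂ} {a c g : ι → ℝ}
    (hU : U ∈ Matrix.unitaryGroup ι ℂ) (hU' : U' ∈ Matrix.unitaryGroup ι ℂ)
    (hU'' : U'' ∈ Matrix.unitaryGroup ι ℂ)
    (ha : Antitone (a ∘ e)) (hc : Antitone (c ∘ e))
    (h : U' * Matrix.diagonal (fun i => (c i : ℂ)) * U'ᴴ =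
      U * Matrix.diagonal (fun i => (a i : ℂ)) * Uᴴ +
        U'' * Matrix.diagonal (fun i => (g i : ℂ)) * U''ᴴ) (τ : ℝ) (I : Finset ι) :
    ∑ i ∈ I, (c i - a i) ≤ I.card * τ + ∑ i, max (g i - τ) 0 := by
  set A := U * Matrix.diagonal (fun i => (a i : ℂ)) * Uᴴ with hA
  set C := U' * Matrix.diagonal (fun i => (c i : ℂ)) * U'ᴴ with hC
  set G := U'' * Matrix.diagonal (fun i => (g i : ℂ)) * U''ᴴ with hG
  -- `P` is the positive part of `G - τ`. Since `P ≥ 0` and `G ≤ P + τ`, the eigenvalues `d` of `A +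
  -- P` satisfy `a ≤ d` and `c ≤ d + τ`. As all `d i - a i` are nonnegative, their sum over `I` is
  -- at most their total sum, which is the trace of `P`.
  set p : ι → ℝ := fun i => max (g i - τ) 0 with hp
  set P := U'' * Matrix.diagonal (fun i => (p i : ℂ)) * U''ᴴ with hP
  have hH : (A + P).IsHermitian :=
    (isHermitian_diagonalized U a).add (isHermitian_diagonalized U'' p)
  obtain ⟨Q, hQ, d, hd, hHd⟩ := exists_sorted_diagonalization e hH
  have had : ∀ i, a i ≤ d i := by
    refine weyl_monotone e hU hQ ha hd hA hHd fun x => ?_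
    rw [Matrix.add_mulVec, dotProduct_add, Complex.add_re, re_quadForm_diagonalized hP,
      le_add_iff_nonneg_right]
    exact Finset.sum_nonneg fun i _ => mul_nonneg (le_max_right _ _) (sq_nonneg _)
  have hcd : ∀ i, c i ≤ d i + τ := by
    have hd' : Antitone ((fun i => d i + τ) ∘ e) := fun x y hxy => by
      have := hd hxy
      simp only [Function.comp_apply] at this ⊢
      linarith
    have hτ : A + P + (τ : ℂ) • (1 : Matrix ι ι ℂ) =
        Q * Matrix.diagonal (fun i => ((d i + τ : ℝ) : ℂ)) * Qᴴ := by
      have : Matrix.diagonal (fun i => ((d i + τ : ℝ) : ℂ)) =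
          Matrix.diagonal (fun i => (d i : ℂ)) + (τ : ℂ) • (1 : Matrix ι ι ℂ) := by
        ext i j
        by_cases hij : i = j <;> simp [hij]
      rw [this, Matrix.mul_add, Matrix.add_mul, ← hHd, Matrix.mul_smul, Matrix.mul_one,
        Matrix.smul_mul, unitary_mul_conjTranspose_self hQ]
    refine weyl_monotone e hU' hQ hc hd' hC hτ fun x => ?_
    have h1 : star x ⬝ᵥ (((τ : ℂ) • (1 : Matrix ι ι ℂ)) *ᵥ x) =
        star x ⬝ᵥ ((U'' * Matrix.diagonal (fun i => ((fun _ => τ : ι → ℝ) i : ℂ)) * U''ᴴ) *ᵥ x) := by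
      congr 2
      have : Matrix.diagonal (fun _ : ι => (τ : ℂ)) = (τ : ℂ) • (1 : Matrix ι ι ℂ) := by
        ext i j
        by_cases hij : i = j <;> simp [hij]
      simp only [this]
      rw [Matrix.mul_smul, Matrix.mul_one, Matrix.smul_mul, unitary_mul_conjTranspose_self hU'']
    rw [h, Matrix.add_mulVec, Matrix.add_mulVec, Matrix.add_mulVec, dotProduct_add,
      dotProduct_add, dotProduct_add, h1, Complex.add_re, Complex.add_re, Complex.add_re,
      re_quadForm_diagonalized hG, re_quadForm_diagonalized hP,
      re_quadForm_diagonalized (d := fun _ => τ) rfl, add_assoc, add_le_add_iff_left,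
      ← Finset.sum_add_distrib]
    refine Finset.sum_le_sum fun i _ => ?_
    rw [← add_mul]
    gcongr
    have := le_max_left (g i - τ) 0
    simp only [hp]
    linarith
  have htr : ∑ i, d i = ∑ i, a i + ∑ i, p i := by
    have h1 := congrArg Matrix.trace hHd
    rw [Matrix.trace_add, hA, hP, trace_unitary_conj hU, trace_unitary_conj hU'',
      trace_unitary_conj hQ, Matrix.trace_diagonal, Matrix.trace_diagonal,
      Matrix.trace_diagonal] at h1
    exact_mod_cast h1.symm
  calc ∑ i ∈ I, (c i - a i) ≤ ∑ i ∈ I, (τ + (d i - a i)) :=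
        Finset.sum_le_sum fun i _ => by linarith [hcd i]
    _ = I.card * τ + ∑ i ∈ I, (d i - a i) := by
        rw [Finset.sum_add_distrib, Finset.sum_const, nsmul_eq_mul]
    _ ≤ I.card * τ + ∑ i, (d i - a i) := by
        gcongr
        · exact fun i _ _ => sub_nonneg.2 (had i)
        · exact Finset.subset_univ _
    _ = I.card * τ + ∑ i, max (g i - τ) 0 := by
        rw [Finset.sum_sub_distrib, htr]; simp [hp]

end Unitary

/-! ### Singular values and the singular value decomposition -/

section SingVal

variable {m n : ℕ} (F : Matrix (Fin m) (Fin n) ℂ)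

lemma singVal_succ (i : ℕ) :
    singVal F (i + 1) = (Matrix.toEuclideanLin F).singularValues i := rfl

lemma singVal_nonneg (j : ℕ) : 0 ≤ singVal F j := LinearMap.singularValues_nonneg _ _

lemma singVal_succ_antitone : Antitone fun i => singVal F (i + 1) := fun _ _ h =>
  LinearMap.singularValues_antitone (Matrix.toEuclideanLin F) h

lemma rank_eq_finrank_range_toEuclideanLin :
    F.rank = Module.finrank ℂ (LinearMap.range (Matrix.toEuclideanLin F)) := by
  rw [Matrix.toEuclideanLin, Matrix.toLpLin_eq_toLin]
  exact Matrix.rank_eq_finrank_range_toLin F _ _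

lemma singVal_succ_pos_iff (i : ℕ) : 0 < singVal F (i + 1) ↔ i < F.rank := by
  rw [rank_eq_finrank_range_toEuclideanLin]
  exact LinearMap.singularValues_pos_iff_lt_finrank_range _

lemma singVal_succ_eq_zero_iff (i : ℕ) : singVal F (i + 1) = 0 ↔ F.rank ≤ i := by
  rw [rank_eq_finrank_range_toEuclideanLin]
  exact LinearMap.singularValues_eq_zero_iff_le_finrank_range _

lemma rank_le_min : F.rank ≤ min m n :=
  le_min F.rank_le_height F.rank_le_width

lemma singVal_succ_eq_zero_of_le {i : ℕ} (h : min m n ≤ i) : singVal F (i + 1) = 0 :=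
  (singVal_succ_eq_zero_iff F i).2 ((rank_le_min F).trans h)

lemma sigma_eq_rectDiag : sigma F = rectDiag m n fun i => (singVal F (i + 1) : ℂ) := rfl

/-- Existence of singular value decompositions. -/
lemma exists_isSVD : ∃ V W, IsSVD F V W := by
  set T := Matrix.toEuclideanLin F with hTdef
  have hn : Module.finrank ℂ (EuclideanSpace ℂ (Fin n)) = n := finrank_euclideanSpace_fin
  set s : ℕ → ℝ := fun i => singVal F (i + 1) with hs
  set b := T.isSymmetric_adjoint_comp_self.eigenvectorBasis hn with hb
  have hinner : ∀ i j, inner ℂ (T (b i)) (T (b j)) = if i = j then ((s j : ℂ)) ^ 2 else 0 := by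
    intro i j
    rw [← LinearMap.adjoint_inner_right]
    have := T.isSymmetric_adjoint_comp_self.apply_eigenvectorBasis hn j
    rw [LinearMap.comp_apply] at this
    rw [hb, this, inner_smul_right, ← hb, orthonormal_iff_ite.1 b.orthonormal i j,
      ← T.sq_singularValues_fin hn]
    split_ifs <;> simp [hs, singVal_succ, hTdef]
  -- The left singular vectors are the normalized images of the eigenvectors of `F* F`. They are
  -- orthonormal for indices below the rank; the values beyond it are discarded when the family is
  -- extended to a basis.
  let v : Fin m → EuclideanSpace ℂ (Fin m) := fun i =>
    if h : i.val < n then ((s i : ℂ))⁻¹ • T (b ⟨i.val, h⟩) else 0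
  have hv : Orthonormal ℂ (({i : Fin m | i.val < F.rank} : Set (Fin m)).domRestrict v) := by
    rw [orthonormal_iff_ite]
    rintro ⟨i, hi⟩ ⟨j, hj⟩
    simp only [Set.mem_ofPred_eq] at hi hj
    have hin : i.val < n := hi.trans_le F.rank_le_width
    have hjn : j.val < n := hj.trans_le F.rank_le_width
    simp only [Set.domRestrict_apply, v, hin, hjn, dif_pos, inner_smul_left, inner_smul_right,
      hinner]
    have hsi : (s i : ℂ) ≠ 0 := by
      exact_mod_cast ((singVal_succ_pos_iff F i).2 hi).ne'
    by_cases hij : i = j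
    · subst hij
      simp only [if_true, map_inv₀, Complex.conj_ofReal]
      field_simp
    · have : ¬ (⟨i.val, hin⟩ : Fin n) = ⟨j.val, hjn⟩ := fun h => hij (Fin.ext (by simpa using h))
      simp [hij, this]
  obtain ⟨b', hb'⟩ := hv.exists_orthonormalBasis_extension_of_card_eq (by simp)
  refine ⟨onbMatrix b', onbMatrix b, onbMatrix_mem _, onbMatrix_mem _, ?_⟩
  have key : F * onbMatrix b = onbMatrix b' * sigma F := by
    ext i j
    have h1 : (F * onbMatrix b) i j = T (b j) i := by
      simp only [Matrix.mul_apply, onbMatrix, Matrix.of_apply, hTdef, Matrix.toLpLin_apply,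
        Matrix.mulVec, dotProduct]
    have h0 : F.rank ≤ j.val → T (b j) = 0 := fun h => by
      rw [← inner_self_eq_zero (𝕜 := ℂ), hinner]
      simp [hs, (singVal_succ_eq_zero_iff F j.val).2 h]
    rw [h1, Matrix.mul_apply]
    rcases lt_or_ge j.val F.rank with hj | hj
    · have hjm : j.val < m := hj.trans_le F.rank_le_height
      have hsj : (s j : ℂ) ≠ 0 := by
        exact_mod_cast ((singVal_succ_pos_iff F j).2 hj).ne'
      rw [Finset.sum_eq_single (⟨j.val, hjm⟩ : Fin m)]
      · have := hb' ⟨j.val, hjm⟩ hj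
        simp only [onbMatrix, Matrix.of_apply, this, v, j.2, dif_pos, sigma, if_true]
        rw [PiLp.smul_apply, smul_eq_mul]
        simp only [hs] at hsj ⊢
        field_simp
      · intro l _ hl
        simp only [sigma, Matrix.of_apply]
        rw [if_neg (fun h => hl (Fin.ext h)), mul_zero]
      · simp
    · rw [h0 hj, Finset.sum_eq_zero]
      · rfl
      · intro l _
        simp only [sigma, Matrix.of_apply]
        split_ifs with h
        · rw [(singVal_succ_eq_zero_iff F _).2 (h ▸ hj)]; simp
        · simp
  rw [← key, Matrix.mul_assoc, unitary_mul_conjTranspose_self (onbMatrix_mem b), Matrix.mul_one]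

end SingVal

/-- Both families have the same sorted version, so composing one sorting permutation with the
inverse of the other matches them. -/
lemma exists_perm_of_map_univ_eq {q : ℕ} {f g : Fin q → ℝ}
    (h : (Finset.univ.val.map f : Multiset ℝ) = Finset.univ.val.map g) :
    ∃ σ : Equiv.Perm (Fin q), ∀ i, f i = g (σ i) := by
  have perm_sort : ∀ u : Fin q → ℝ,
      (Finset.univ.val.map (u ∘ Tuple.sort u) : Multiset ℝ) = Finset.univ.val.map u := fun u => by
    rw [← Multiset.map_map]
    congr 1
    exact Multiset.map_univ_val_equiv (Tuple.sort u)
  have key : f ∘ Tuple.sort f = g ∘ Tuple.sort g := by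
    apply List.ofFn_injective
    refine List.Perm.eq_of_sortedLE (Tuple.monotone_sort f).sortedLE_ofFn
      (Tuple.monotone_sort g).sortedLE_ofFn ?_
    rw [← Multiset.coe_eq_coe, ← Fin.univ_val_map, ← Fin.univ_val_map, perm_sort, perm_sort, h]
  refine ⟨(Tuple.sort f).symm.trans (Tuple.sort g), fun i => ?_⟩
  have := congrFun key ((Tuple.sort f).symm i)
  simpa using this

/-! ### Unitary invariance of singular values and of the gauge norm -/

section Invariance

variable {m n : ℕ}

lemma conjTranspose_mul_self_of_eq {G : Matrix (Fin m) (Fin n) ℂ}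
    {V : Matrix (Fin m) (Fin m) ℂ} {W : Matrix (Fin n) (Fin n) ℂ} {d : ℕ → ℂ}
    (hV : V ∈ Matrix.unitaryGroup (Fin m) ℂ) (hG : G = V * rectDiag m n d * Wᴴ) :
    Gᴴ * G = W * rectDiag n n (fun i => if i < m then ((‖d i‖ ^ 2 : ℝ) : ℂ) else 0) * Wᴴ := by
  have h1 : (rectDiag m n d)ᴴ * rectDiag m n d =
      rectDiag n n (fun i => if i < m then ((‖d i‖ ^ 2 : ℝ) : ℂ) else 0) := by
    rw [rectDiag_conjTranspose, rectDiag_mul]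
    refine rectDiag_congr fun i _ _ => ?_
    split_ifs
    · rw [← starRingEnd_apply, Complex.conj_mul']
      push_cast
      rfl
    · rfl
  rw [← h1, hG]
  simp only [Matrix.conjTranspose_mul, Matrix.conjTranspose_conjTranspose, Matrix.mul_assoc]
  rw [← Matrix.mul_assoc Vᴴ V, unitary_conjTranspose_mul_self hV, Matrix.one_mul]

-- The factor `X ^ (n - min m n)` depends only on the format, not on `d`. It can be cancelled when
-- two factorizations of the same `G` are compared, leaving exactly the squared moduli of the
-- diagonal entries as roots.
open Polynomial in
lemma charpoly_conjTranspose_mul_self {G : Matrix (Fin m) (Fin n) ℂ}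
    {V : Matrix (Fin m) (Fin m) ℂ} {W : Matrix (Fin n) (Fin n) ℂ} {d : ℕ → ℂ}
    (hV : V ∈ Matrix.unitaryGroup (Fin m) ℂ) (hW : W ∈ Matrix.unitaryGroup (Fin n) ℂ)
    (hG : G = V * rectDiag m n d * Wᴴ) :
    (Gᴴ * G).charpoly =
      (∏ i : Fin (min m n), (X - C ((‖d i‖ ^ 2 : ℝ) : ℂ))) * X ^ (n - min m n) := by
  have h1 : (Gᴴ * G).charpoly =
      ∏ i ∈ Finset.range n, (X - C (if i < m then ((‖d i‖ ^ 2 : ℝ) : ℂ) else 0)) := by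
    rw [conjTranspose_mul_self_of_eq hV hG, Matrix.charpoly_mul_comm, ← Matrix.mul_assoc,
      unitary_conjTranspose_mul_self hW, Matrix.one_mul, rectDiag_self, Matrix.charpoly_diagonal,
      Finset.prod_range]
  have hsplit : n = min m n + (n - min m n) := by omega
  rw [h1]
  conv_lhs => rw [hsplit]
  rw [Finset.prod_range_add]
  congr 1
  · rw [Finset.prod_range]
    refine Finset.prod_congr rfl fun i _ => ?_
    rw [if_pos (i.2.trans_le (min_le_left _ _))]
  · rw [← Finset.card_range (n - min m n), ← Finset.prod_const, Finset.card_range]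
    refine Finset.prod_congr rfl fun i hi => ?_
    have := Finset.mem_range.1 hi
    rw [if_neg (by omega), C_0, sub_zero]

open Polynomial in
/-- The singular values of `V D W*`, `D` diagonal, are the moduli of the diagonal entries. -/
lemma exists_perm_singVal {G : Matrix (Fin m) (Fin n) ℂ}
    {V : Matrix (Fin m) (Fin m) ℂ} {W : Matrix (Fin n) (Fin n) ℂ} {d : ℕ → ℂ}
    (hV : V ∈ Matrix.unitaryGroup (Fin m) ℂ) (hW : W ∈ Matrix.unitaryGroup (Fin n) ℂ)
    (hG : G = V * rectDiag m n d * Wᴴ) :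
    ∃ σ : Equiv.Perm (Fin (min m n)), ∀ i : Fin (min m n),
      singVal G (i.val + 1) = ‖d (σ i).val‖ := by
  obtain ⟨V', W', hV', hW', hG'⟩ := exists_isSVD G
  rw [sigma_eq_rectDiag] at hG'
  have h := (charpoly_conjTranspose_mul_self hV' hW' hG').symm.trans
    (charpoly_conjTranspose_mul_self hV hW hG)
  have h2 := congrArg Polynomial.roots (mul_right_cancel₀ (pow_ne_zero _ X_ne_zero) h)
  have hroots : ∀ u : Fin (min m n) → ℂ, (∏ i, (X - C (u i))).roots = Finset.univ.val.map u := by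
    intro u
    rw [Polynomial.roots_prod _ _ (Finset.prod_ne_zero_iff.2 fun i _ => X_sub_C_ne_zero _)]
    simp
  rw [hroots, hroots] at h2
  -- The roots are squared moduli viewed in `ℂ`; taking the square root of the real part recovers
  -- the moduli.
  have h3 := congrArg (Multiset.map fun z : ℂ => √z.re) h2
  simp only [Multiset.map_map, Function.comp_def, Complex.ofReal_re, Real.sqrt_sq (norm_nonneg _)]
    at h3
  obtain ⟨σ, hσ⟩ := exists_perm_of_map_univ_eq h3
  refine ⟨σ, fun i => ?_⟩
  rw [← hσ i, Complex.norm_real, Real.norm_of_nonneg (singVal_nonneg _ _)]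

lemma sum_sq_singVal_of_eq {G : Matrix (Fin m) (Fin n) ℂ}
    {V : Matrix (Fin m) (Fin m) ℂ} {W : Matrix (Fin n) (Fin n) ℂ} {d : ℕ → ℂ}
    (hV : V ∈ Matrix.unitaryGroup (Fin m) ℂ) (hW : W ∈ Matrix.unitaryGroup (Fin n) ℂ)
    (hG : G = V * rectDiag m n d * Wᴴ) :
    (Gᴴ * G).trace = ∑ i : Fin (min m n), ((‖d i‖ ^ 2 : ℝ) : ℂ) := by
  have hsplit : n = min m n + (n - min m n) := by omega
  rw [conjTranspose_mul_self_of_eq hV hG, trace_unitary_conj hW, rectDiag_self,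
    Matrix.trace_diagonal,
    ← Finset.sum_range fun i => if i < m then ((‖d i‖ ^ 2 : ℝ) : ℂ) else 0]
  conv_lhs => rw [hsplit]
  rw [Finset.sum_range_add, Finset.sum_range]
  conv_rhs => rw [← add_zero (∑ i : Fin (min m n), _)]
  congr 1
  · refine Finset.sum_congr rfl fun i _ => ?_
    rw [if_pos (i.2.trans_le (min_le_left _ _))]
  · refine Finset.sum_eq_zero fun i hi => ?_
    have := Finset.mem_range.1 hi
    rw [if_neg (by omega)]

lemma trace_conjTranspose_mul_self (G : Matrix (Fin m) (Fin n) ℂ) :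
    (Gᴴ * G).trace = ((∑ i : Fin (min m n), singVal G (i.val + 1) ^ 2 : ℝ) : ℂ) := by
  obtain ⟨V, W, hV, hW, hG⟩ := exists_isSVD G
  rw [sum_sq_singVal_of_eq hV hW (hG.trans (by rw [sigma_eq_rectDiag]))]
  push_cast
  simp [Complex.norm_real, ← Complex.ofReal_pow]

/-- The norm of `V D W*`, `D` diagonal. -/
lemma gaugeNorm_of_eq {Φ : Seminorm ℝ (Fin (min m n) → ℝ)} (hΦ : IsSymmetricGauge Φ)
    {G : Matrix (Fin m) (Fin n) ℂ}
    {V : Matrix (Fin m) (Fin m) ℂ} {W : Matrix (Fin n) (Fin n) ℂ} {d : ℕ → ℝ}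
    (hV : V ∈ Matrix.unitaryGroup (Fin m) ℂ) (hW : W ∈ Matrix.unitaryGroup (Fin n) ℂ)
    (hG : G = V * rectDiag m n (fun i => (d i : ℂ)) * Wᴴ) :
    gaugeNorm Φ G = Φ fun i => d i.val := by
  obtain ⟨σ, hσ⟩ := exists_perm_singVal hV hW hG
  rw [gaugeNorm, hΦ.map_abs_perm (fun i => d i.val) σ]
  congr 1
  ext i
  rw [hσ i, Complex.norm_real, Real.norm_eq_abs]

end Invariance

/-! ### Hermitian dilation and Mirsky's inequality -/

section Dilation

variable {m n : ℕ}

/-- The Hermitian dilation of `V D W*`, `D` real diagonal, is unitarily diagonalizable with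
eigenvalues the diagonal entries of `D`, their negatives, and zeros. -/
lemma exists_dilation_diagonalization {F : Matrix (Fin m) (Fin n) ℂ}
    {V : Matrix (Fin m) (Fin m) ℂ} {W : Matrix (Fin n) (Fin n) ℂ} {s : ℕ → ℝ}
    (hs : ∀ i, min m n ≤ i → s i = 0)
    (hV : V ∈ Matrix.unitaryGroup (Fin m) ℂ) (hW : W ∈ Matrix.unitaryGroup (Fin n) ℂ)
    (hF : F = V * rectDiag m n (fun i => (s i : ℂ)) * Wᴴ) :
    ∃ U ∈ Matrix.unitaryGroup (Fin m ⊕ Fin n) ℂ,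
      Matrix.fromBlocks 0 F Fᴴ 0 = U * Matrix.diagonal (fun x => ((Sum.elim
        (fun i : Fin m => s i) (fun j : Fin n => -s j) x : ℝ) : ℂ)) * Uᴴ := by
  set t : ℂ := ((√2 : ℝ) : ℂ)⁻¹ with ht
  have htt : t * t = 1 / 2 := by
    rw [ht, ← mul_inv, ← Complex.ofReal_mul, Real.mul_self_sqrt (by norm_num)]
    norm_num
  have hstar : star t = t := by
    rw [ht, ← Complex.ofReal_inv, ← starRingEnd_apply, Complex.conj_ofReal]
  set α : ℕ → ℂ := fun i => if i < min m n then t else 1 with hα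
  have hαstar : ∀ i, star (α i) = α i := fun i => by
    simp only [hα]; split_ifs <;> simp [hstar]
  -- `R` applies the reflection `(1/√2) [[1, 1], [1, -1]]` to each pair of `i`-th coordinates with
  -- `i < min m n`, and `±1` to the unpaired coordinates. It is a Hermitian involution whose columns
  -- are eigenvectors of the dilation of the diagonal matrix.
  set R : Matrix (Fin m ⊕ Fin n) (Fin m ⊕ Fin n) ℂ :=
    Matrix.fromBlocks (rectDiag m m α) (rectDiag m n fun _ => t) (rectDiag n m fun _ => t)
      (-rectDiag n n α) with hR
  have hRH : Rᴴ = R := by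
    rw [hR, Matrix.fromBlocks_conjTranspose, Matrix.conjTranspose_neg]
    simp only [rectDiag_conjTranspose, hstar, hαstar]
  have hRR : R * R = 1 := by
    rw [hR, Matrix.fromBlocks_multiply, ← Matrix.fromBlocks_one]
    simp only [rectDiag_mul, rectDiag_neg, rectDiag_add]
    congr 1
    · rw [← rectDiag_one]
      refine rectDiag_congr fun i hi _ => ?_
      by_cases hin : i < n
      · simp [hα, hi, hin, htt]; norm_num
      · simp [hα, hi, hin]
    · rw [← rectDiag_zero]
      refine rectDiag_congr fun i hi hin => ?_
      simp [hα, hi, hin]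
    · rw [← rectDiag_zero]
      refine rectDiag_congr fun i hi hin => ?_
      simp [hα, hi, hin]
    · rw [← rectDiag_one]
      refine rectDiag_congr fun i hi _ => ?_
      by_cases hin : i < m
      · simp [hα, hi, hin, htt]; norm_num
      · simp [hα, hi, hin]
  set Δ : Matrix (Fin m ⊕ Fin n) (Fin m ⊕ Fin n) ℂ := Matrix.diagonal (fun x => ((Sum.elim
        (fun i : Fin m => s i) (fun j : Fin n => -s j) x : ℝ) : ℂ)) with hΔ
  have hΔ' : Δ = Matrix.fromBlocks (rectDiag m m fun i => (s i : ℂ)) 0 0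
      (-rectDiag n n fun i => (s i : ℂ)) := by
    rw [rectDiag_neg, rectDiag_self, rectDiag_self, Matrix.fromBlocks_diagonal, hΔ]
    congr 1
    ext x
    rcases x with x | x <;> simp
  have hmid : Matrix.fromBlocks 0 (rectDiag m n fun i => (s i : ℂ))
      (rectDiag m n fun i => (s i : ℂ))ᴴ 0 * R = R * Δ := by
    rw [hΔ', hR, Matrix.fromBlocks_multiply, Matrix.fromBlocks_multiply]
    simp only [rectDiag_mul, rectDiag_neg,
      rectDiag_conjTranspose, Matrix.zero_mul, Matrix.mul_zero, zero_add, add_zero]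
    congr 1
    · refine rectDiag_congr fun i hi _ => ?_
      by_cases hin : i < n
      · simp [hα, hi, hin, mul_comm]
      · simp [hi, hin, hs i (by omega)]
    · refine rectDiag_congr fun i hi hin => ?_
      simp [hα, hi, hin, mul_comm]
    · refine rectDiag_congr fun i hi hin => ?_
      simp [hα, hi, hin, mul_comm]
    · refine rectDiag_congr fun i hi _ => ?_
      by_cases hin : i < m
      · simp [hα, hi, hin, mul_comm]
      · simp [hi, hin, hs i (by omega)]
  set Z : Matrix (Fin m ⊕ Fin n) (Fin m ⊕ Fin n) ℂ := Matrix.fromBlocks V 0 0 W with hZ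
  have hZH : Zᴴ = Matrix.fromBlocks Vᴴ 0 0 Wᴴ := by
    rw [hZ, Matrix.fromBlocks_conjTranspose]; simp
  have hZZ : Zᴴ * Z = 1 := by
    rw [hZH, hZ, Matrix.fromBlocks_multiply]
    simp [unitary_conjTranspose_mul_self hV, unitary_conjTranspose_mul_self hW]
  refine ⟨Z * R, unitary_of_conjTranspose_mul_self ?_, ?_⟩
  · rw [Matrix.conjTranspose_mul, Matrix.mul_assoc, ← Matrix.mul_assoc Zᴴ, hZZ, Matrix.one_mul,
      hRH, hRR]
  · rw [Matrix.mul_assoc Z R, ← hmid, Matrix.conjTranspose_mul, hRH]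
    have : ∀ K : Matrix (Fin m ⊕ Fin n) (Fin m ⊕ Fin n) ℂ, Z * (K * R) * (R * Zᴴ) = Z * K * Zᴴ := by
      intro K
      rw [Matrix.mul_assoc, Matrix.mul_assoc K, ← Matrix.mul_assoc R, hRR, Matrix.one_mul,
        ← Matrix.mul_assoc]
    rw [this, hZH, hZ, Matrix.fromBlocks_multiply, Matrix.fromBlocks_multiply]
    simp [hF, Matrix.mul_assoc]

/-- The enumeration of `Fin m ⊕ Fin n` along which the eigenvalues of a dilation decrease. -/
def dilationEnum (m n : ℕ) : Fin (m + n) ≃ Fin m ⊕ Fin n :=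
  finSumFinEquiv.symm.trans (Equiv.sumCongr (Equiv.refl _) Fin.revPerm)

lemma antitone_elim_dilationEnum {s : ℕ → ℝ} (hs : Antitone s) (h0 : ∀ i, 0 ≤ s i) :
    Antitone ((Sum.elim (fun i : Fin m => s i) (fun j : Fin n => -s j)) ∘ dilationEnum m n) := by
  intro x y
  induction x using Fin.addCases with
  | left x =>
    induction y using Fin.addCases with
    | left y =>
      intro h
      simpa [dilationEnum] using hs (Fin.le_def.1 h)
    | right y =>
      intro h
      simp only [dilationEnum, Function.comp_apply, Equiv.trans_apply,
        finSumFinEquiv_symm_apply_castAdd, finSumFinEquiv_symm_apply_natAdd,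
        Equiv.sumCongr_apply, Sum.map_inl, Sum.map_inr, Sum.elim_inl, Sum.elim_inr]
      linarith [h0 (Fin.revPerm y).val, h0 ((Equiv.refl (Fin m)) x).val]
  | right x =>
    induction y using Fin.addCases with
    | left y =>
      intro h
      have := Fin.le_def.1 h
      simp at this
      omega
    | right y =>
      intro h
      have h' : x ≤ y := by simpa using h
      simp only [dilationEnum, Function.comp_apply, Equiv.trans_apply,
        finSumFinEquiv_symm_apply_natAdd, Equiv.sumCongr_apply, Sum.map_inr, Sum.elim_inr,
        neg_le_neg_iff]
      exact hs (Fin.le_def.1 (Fin.rev_le_rev.2 h'))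

/-- Mirsky's inequality for singular values, as a weak majorization. -/
lemma sum_abs_singVal_sub_le (F X : Matrix (Fin m) (Fin n) ℂ) (I : Finset (Fin (min m n))) :
    ∑ i ∈ I, |singVal F (i.val + 1) - singVal X (i.val + 1)| ≤
      ∑ i ∈ Finset.range I.card, singVal (F - X) (i + 1) := by
  have dil : ∀ M : Matrix (Fin m) (Fin n) ℂ, ∃ U ∈ Matrix.unitaryGroup (Fin m ⊕ Fin n) ℂ,
      Matrix.fromBlocks 0 M Mᴴ 0 = U * Matrix.diagonal (fun x => ((Sum.elim
        (fun i : Fin m => singVal M (i + 1)) (fun j : Fin n => -singVal M (j + 1)) x : ℝ) : ℂ))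
          * Uᴴ := fun M => by
    obtain ⟨V, W, hV, hW, hM⟩ := exists_isSVD M
    exact exists_dilation_diagonalization (s := fun i => singVal M (i + 1))
      (fun i hi => singVal_succ_eq_zero_of_le M hi) hV hW (hM.trans (by rw [sigma_eq_rectDiag]))
  obtain ⟨U, hU, hUX⟩ := dil X
  obtain ⟨U', hU', hUF⟩ := dil F
  obtain ⟨U'', hU'', hUG⟩ := dil (F - X)
  have anti : ∀ M : Matrix (Fin m) (Fin n) ℂ, Antitone ((Sum.elim
      (fun i : Fin m => singVal M (i + 1)) (fun j : Fin n => -singVal M (j + 1))) ∘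
        dilationEnum m n) := fun M =>
    antitone_elim_dilationEnum (singVal_succ_antitone M) fun i => singVal_nonneg M (i + 1)
  -- For each `i`, the eigenvalue `s_i` or `-s_i` is selected so that the difference between the
  -- dilations of `F` and `X` is `|s_i(F) - s_i(X)|`.
  let ψ : Fin (min m n) → Fin m ⊕ Fin n := fun i =>
    if singVal X (i.val + 1) ≤ singVal F (i.val + 1) then
      Sum.inl (i.castLE (min_le_left m n)) else Sum.inr (i.castLE (min_le_right m n))
  have hψ : Function.Injective ψ := by
    intro i j hij
    simp only [ψ] at hij
    split_ifs at hij <;> simpa using hij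
  -- With `τ = s_{|I|+1}(F - X)`, the positive parts single out the `|I|` largest singular values of
  -- `F - X`. The negative eigenvalues contribute nothing, and the terms `|I| τ` cancel.
  have hlid := lidskii (dilationEnum m n) hU hU' hU'' (anti X) (anti F) (g := Sum.elim
      (fun i : Fin m => singVal (F - X) (i + 1)) (fun j : Fin n => -singVal (F - X) (j + 1)))
    (by
      rw [← hUX, ← hUF, ← hUG, Matrix.fromBlocks_add]
      congr 1 <;> simp) (singVal (F - X) (I.card + 1)) (I.image ψ)
  rw [Finset.sum_image (fun _ _ _ _ h => hψ h), Finset.card_image_of_injective _ hψ] at hlid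
  set τ := singVal (F - X) (I.card + 1) with hτ
  have hτ0 : 0 ≤ τ := singVal_nonneg _ _
  have hcard : I.card ≤ m := by
    have := Finset.card_le_univ I
    rw [Fintype.card_fin] at this
    omega
  have hsum : ∑ x : Fin m ⊕ Fin n, max ((Sum.elim (fun i : Fin m => singVal (F - X) (i + 1))
      (fun j : Fin n => -singVal (F - X) (j + 1))) x - τ) 0 =
      ∑ i ∈ Finset.range I.card, (singVal (F - X) (i + 1) - τ) := by
    rw [Fintype.sum_sum_type]
    simp only [Sum.elim_inl, Sum.elim_inr]
    have h1 : ∑ j : Fin n, max (-singVal (F - X) (j.val + 1) - τ) 0 = 0 :=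
      Finset.sum_eq_zero fun j _ =>
        max_eq_right (by linarith [singVal_nonneg (F - X) (j.val + 1)])
    rw [h1, add_zero, ← Finset.sum_range fun i => max (singVal (F - X) (i + 1) - τ) 0]
    rw [← Finset.sum_subset (Finset.range_mono hcard)]
    · refine Finset.sum_congr rfl fun i hi => max_eq_left (sub_nonneg.2 ?_)
      exact singVal_succ_antitone (F - X) (Finset.mem_range.1 hi).le
    · intro i _ hi
      refine max_eq_right (sub_nonpos.2 ?_)
      exact singVal_succ_antitone (F - X) (not_lt.1 fun h => hi (Finset.mem_range.2 h))
  have hsum' : ∑ i ∈ Finset.range I.card, (singVal (F - X) (i + 1) - τ) =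
      ∑ i ∈ Finset.range I.card, singVal (F - X) (i + 1) - I.card * τ := by
    rw [Finset.sum_sub_distrib, Finset.sum_const, Finset.card_range, nsmul_eq_mul]
  rw [hsum, hsum'] at hlid
  calc ∑ i ∈ I, |singVal F (i.val + 1) - singVal X (i.val + 1)|
      = _ := Finset.sum_congr rfl fun i _ => ?_
    _ ≤ _ := hlid
    _ = _ := by ring
  simp only [ψ]
  split_ifs with h
  · rw [abs_of_nonneg (sub_nonneg.2 h)]
    rfl
  · rw [abs_of_nonpos (by linarith)]
    simp only [Sum.elim_inr, Fin.val_castLE]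
    ring

end Dilation

/-! ### Weak majorization and strictly convex gauges -/

section Majorization

/-- Abel summation as an induction: lowering the factor from `c p` to `c (p + 1)` can only decrease
its product with a nonnegative partial sum. -/
lemma mul_sum_le_sum_mul_of_antitone {c t : ℕ → ℝ} {N : ℕ} (hc : Antitone c)
    (ht : ∀ p ≤ N, 0 ≤ ∑ i ∈ Finset.range p, t i) :
    ∀ p ≤ N, c p * ∑ i ∈ Finset.range p, t i ≤ ∑ i ∈ Finset.range p, c i * t i := by
  intro p
  induction p with
  | zero => simp
  | succ p ih =>
    intro hp
    have h1 := ih (by omega)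
    have h2 : c (p + 1) * ∑ i ∈ Finset.range (p + 1), t i ≤
        c p * ∑ i ∈ Finset.range (p + 1), t i :=
      mul_le_mul_of_nonneg_right (hc p.le_succ) (ht _ hp)
    rw [Finset.sum_range_succ (fun i => c i * t i)]
    rw [Finset.sum_range_succ t, mul_add (c p)] at h2
    rw [Finset.sum_range_succ t]
    linarith

variable {q : ℕ}

/-- The vectors obtained from `g` by permuting the coordinates and changing signs. -/
def signedPerms (g : Fin q → ℝ) : Set (Fin q → ℝ) :=
  Set.range fun p : Equiv.Perm (Fin q) × (Fin q → Bool) =>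
    fun j => (if p.2 j then -1 else 1) * g (p.1 j)

lemma signedPerms_finite (g : Fin q → ℝ) : (signedPerms g).Finite := Set.finite_range _

lemma gauge_eq_of_mem_signedPerms {Φ : Seminorm ℝ (Fin q → ℝ)} (hΦ : IsSymmetricGauge Φ)
    {g x : Fin q → ℝ} (hx : x ∈ signedPerms g) : Φ x = Φ g := by
  obtain ⟨⟨σ, ε⟩, rfl⟩ := hx
  rw [hΦ.map_abs_perm g σ, hΦ.map_abs_perm _ 1]
  congr 1
  ext i
  cases h : ε i <;> simp [h]

lemma sum_sq_eq_of_mem_signedPerms {g x : Fin q → ℝ} (hx : x ∈ signedPerms g) :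
    ∑ i, x i ^ 2 = ∑ i, g i ^ 2 := by
  obtain ⟨⟨σ, ε⟩, rfl⟩ := hx
  rw [← Equiv.sum_comp σ fun i => g i ^ 2]
  refine Finset.sum_congr rfl fun i _ => ?_
  cases h : ε i <;> simp [h]

/-- A vector weakly majorized by `g` is in the convex hull of the signed permutations of `g`. -/
lemma mem_convexHull_signedPerms {g : ℕ → ℝ} {w : Fin q → ℝ}
    (hw : ∀ I : Finset (Fin q), ∑ i ∈ I, |w i| ≤ ∑ i ∈ Finset.range I.card, g i) :
    w ∈ convexHull ℝ (signedPerms fun i : Fin q => g i) := by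
  by_contra hnot
  obtain ⟨f, u, hfu, huw⟩ := geometric_hahn_banach_closed_point
    (convex_convexHull ℝ (signedPerms fun i : Fin q => g i))
    ((signedPerms_finite _).isClosed_convexHull ℝ) hnot
  set z : Fin q → ℝ := fun i => f (Pi.single i 1) with hz
  have hf : ∀ x : Fin q → ℝ, f x = ∑ i, x i * z i := fun x => by
    have := LinearMap.pi_apply_eq_sum_univ (f : (Fin q → ℝ) →ₗ[ℝ] ℝ) x
    simp only [ContinuousLinearMap.coe_coe, smul_eq_mul] at this
    rw [this]
    refine Finset.sum_congr rfl fun i _ => ?_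
    rw [hz]
    congr 2
    ext j
    simp [Pi.single_apply, eq_comm]
  -- A separating functional `z` is contradicted by a rearrangement argument: ordering the
  -- coordinates by decreasing `|z|`, the signed permutation `x` places `g` along this order with
  -- the signs of `z`, and `f x` then dominates `f w`.
  set σ := Tuple.sort fun i => -|z i| with hσ
  have hmono : ∀ i j, i ≤ j → |z (σ j)| ≤ |z (σ i)| := fun i j hij => by
    have := Tuple.monotone_sort (fun i => -|z i|) hij
    simpa [hσ] using this
  set x : Fin q → ℝ := fun j => (if decide (z j < 0) then -1 else 1) * g (σ.symm j).val with hx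
  have hxmem : x ∈ signedPerms fun i : Fin q => g i := ⟨(σ.symm, fun j => decide (z j < 0)), rfl⟩
  have hfx : f x = ∑ i, |z (σ i)| * g i.val := by
    rw [hf, ← Equiv.sum_comp σ]
    refine Finset.sum_congr rfl fun i _ => ?_
    simp only [hx, decide_eq_true_eq, Equiv.symm_apply_apply]
    split_ifs with h
    · rw [abs_of_neg h]; ring
    · rw [abs_of_nonneg (not_lt.1 h)]; ring
  have hfw : f w ≤ ∑ i, |z (σ i)| * |w (σ i)| := by
    rw [hf, Equiv.sum_comp σ fun i => |z i| * |w i|]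
    refine Finset.sum_le_sum fun i _ => ?_
    rw [← abs_mul, mul_comm]
    exact le_abs_self _
  set c : ℕ → ℝ := fun i => if h : i < q then |z (σ ⟨i, h⟩)| else 0 with hc
  set t : ℕ → ℝ := fun i => g i - if h : i < q then |w (σ ⟨i, h⟩)| else 0 with ht
  have hcanti : Antitone c := fun i j hij => by
    simp only [hc]
    split_ifs with h1 h2
    · exact hmono _ _ (by simpa using hij)
    · omega
    · exact abs_nonneg _
    · exact le_rfl
  have htsum : ∀ p ≤ q, 0 ≤ ∑ i ∈ Finset.range p, t i := fun p hp => by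
    have h1 := hw (Finset.univ.image fun i : Fin p => σ (i.castLE hp))
    rw [Finset.sum_image (fun _ _ _ _ h => by simpa using h),
      Finset.card_image_of_injective _ (fun _ _ h => by simpa using h), Finset.card_univ,
      Fintype.card_fin] at h1
    rw [Finset.sum_sub_distrib, sub_nonneg, Finset.sum_range fun i =>
      if h : i < q then |w (σ ⟨i, h⟩)| else 0]
    refine le_trans (le_of_eq ?_) h1
    refine Finset.sum_congr rfl fun i _ => ?_
    rw [dif_pos (i.2.trans_le hp)]
    rfl
  have habel := mul_sum_le_sum_mul_of_antitone hcanti htsum q le_rfl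
  -- The extension of `c` by zero beyond `q` makes the boundary term of the Abel summation vanish.
  have hcq : c q = 0 := by simp [hc]
  rw [hcq, zero_mul, Finset.sum_range] at habel
  have hle : ∑ i, |z (σ i)| * |w (σ i)| ≤ ∑ i, |z (σ i)| * g i.val := by
    rw [← sub_nonneg, ← Finset.sum_sub_distrib]
    refine habel.trans (le_of_eq (Finset.sum_congr rfl fun i _ => ?_))
    simp [hc, ht, mul_sub]
  have := hfu x (subset_convexHull ℝ _ hxmem)
  linarith

/-- A strictly convex symmetric gauge function is strictly increasing for weak majorization. -/
lemma gauge_le_of_majorized {Φ : Seminorm ℝ (Fin q → ℝ)} (hΦ : IsSymmetricGauge Φ)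
    (hconv : IsStrictlyConvex Φ) {g : ℕ → ℝ} {w : Fin q → ℝ}
    (hw : ∀ I : Finset (Fin q), ∑ i ∈ I, |w i| ≤ ∑ i ∈ Finset.range I.card, g i) :
    Φ w ≤ Φ (fun i => g i) ∧
      (Φ w = Φ (fun i => g i) → ∑ i, w i ^ 2 = ∑ i : Fin q, g i ^ 2) := by
  set c := Φ fun i : Fin q => g i with hc
  -- Strict convexity says that the open ball stays convex when any set of points of its sphere is
  -- added. Hence `T` contains the convex hull of the signed permutations, and `w` is either in the
  -- open ball or itself a signed permutation.
  set T : Set (Fin q → ℝ) := {x | Φ x < c} ∪ signedPerms fun i : Fin q => g i with hT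
  have hTle : ∀ x ∈ T, Φ x ≤ c := by
    rintro x (hx | hx)
    · exact le_of_lt hx
    · exact (gauge_eq_of_mem_signedPerms hΦ hx).le
  have hTconv : Convex ℝ T := by
    rw [convex_iff_forall_pos]
    intro x hx y hy a b ha hb hab
    have hxc := hTle x hx
    have hyc := hTle y hy
    by_cases hxy : x = y
    · rwa [← hxy, ← add_smul, hab, one_smul]
    refine Or.inl ?_
    have htri : Φ (a • x + b • y) ≤ a * Φ x + b * Φ y := by
      refine (map_add_le_add Φ _ _).trans (le_of_eq ?_)
      rw [map_smul_eq_mul, map_smul_eq_mul, Real.norm_of_nonneg ha.le, Real.norm_of_nonneg hb.le]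
    change Φ (a • x + b • y) < c
    have hb' : b = 1 - a := by linarith
    rcases lt_or_eq_of_le hxc with h1 | h1
    · have := mul_lt_mul_of_pos_left h1 ha
      have := mul_le_mul_of_nonneg_left hyc hb.le
      calc _ ≤ _ := htri
        _ < a * c + b * c := by linarith
        _ = c := by rw [← add_mul, hab, one_mul]
    rcases lt_or_eq_of_le hyc with h2 | h2
    · have := mul_lt_mul_of_pos_left h2 hb
      have := mul_le_mul_of_nonneg_left hxc ha.le
      calc _ ≤ _ := htri
        _ < a * c + b * c := by linarith
        _ = c := by rw [← add_mul, hab, one_mul]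
    have hc0 : 0 ≤ c := apply_nonneg Φ _
    rcases hc0.eq_or_lt with h0 | h0
    · exact absurd ((hΦ.eq_zero_of_map_eq_zero x (h1.trans h0.symm)).trans
        (hΦ.eq_zero_of_map_eq_zero y (h2.trans h0.symm)).symm) hxy
    · have hnorm : ∀ v, Φ v = c → Φ (c⁻¹ • v) = 1 := fun v hv => by
        rw [map_smul_eq_mul, hv, Real.norm_of_nonneg (inv_nonneg.2 h0.le), inv_mul_cancel₀ h0.ne']
      have h3 := hconv (c⁻¹ • x) (c⁻¹ • y)
        (fun h => hxy (smul_right_injective _ (inv_ne_zero h0.ne') h)) (hnorm x h1) (hnorm y h2)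
        a ha (by linarith)
      rw [← hb', smul_comm a, smul_comm b, ← smul_add, map_smul_eq_mul,
        Real.norm_of_nonneg (inv_nonneg.2 h0.le), inv_mul_lt_iff₀ h0, mul_one] at h3
      exact h3
  have hmem : w ∈ T := convexHull_min Set.subset_union_right hTconv (mem_convexHull_signedPerms hw)
  refine ⟨hTle w hmem, fun h => ?_⟩
  rcases hmem with h1 | h1
  · exact absurd h (ne_of_lt h1)
  · exact sum_sq_eq_of_mem_signedPerms h1

end Majorization

/-! ### Algebraic description of partial isometries -/

section PartialIsometry

variable {m n : ℕ}

/-- A matrix `X` is a partial isometry iff `X X* X = X`. -/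
lemma isPartialIsometry_iff (X : Matrix (Fin m) (Fin n) ℂ) :
    IsPartialIsometry X ↔ X * Xᴴ * X = X := by
  set T := Matrix.toEuclideanLin X with hT
  have hcomp : X * Xᴴ * X = X ↔ ∀ f, T (T.adjoint (T f)) = T f := by
    rw [← (Matrix.toEuclideanLin (𝕜 := ℂ) (m := Fin m) (n := Fin n)).injective.eq_iff,
      LinearMap.ext_iff]
    have h1 : Matrix.toEuclideanLin (X * Xᴴ * X) = T ∘ₗ T.adjoint ∘ₗ T := by
      rw [hT, ← Matrix.toEuclideanLin_conjTranspose_eq_adjoint, Matrix.mul_assoc]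
      rw [Matrix.toEuclideanLin, Matrix.toLpLin_mul_same, Matrix.toLpLin_mul_same]
    rw [h1]
    rfl
  have hadj : ∀ v, T.adjoint v ∈ (LinearMap.ker T)ᗮ := fun v => by
    rw [Submodule.mem_orthogonal]
    intro u hu
    rw [LinearMap.adjoint_inner_right, LinearMap.mem_ker.1 hu, inner_zero_left]
  have hdisj : ∀ v, v ∈ LinearMap.ker T → v ∈ (LinearMap.ker T)ᗮ → v = 0 := fun v h1 h2 =>
    inner_self_eq_zero.1 (Submodule.mem_orthogonal _ _ |>.1 h2 v h1)
  rw [hcomp]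
  constructor
  · intro h f
    -- A norm-preserving linear map preserves inner products, so `T* T` is the identity on the
    -- orthogonal complement of the kernel.
    let L : ↥(LinearMap.ker T)ᗮ →ₗᵢ[ℂ] EuclideanSpace ℂ (Fin m) :=
      { toLinearMap := T.domRestrict (LinearMap.ker T)ᗮ
        norm_map' := fun x => h x.1 x.2 }
    have key : ∀ v ∈ (LinearMap.ker T)ᗮ, T.adjoint (T v) = v := fun v hv => by
      have hd : T.adjoint (T v) - v ∈ (LinearMap.ker T)ᗮ := Submodule.sub_mem _ (hadj _) hv
      have := L.inner_map_map ⟨_, hd⟩ ⟨v, hv⟩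
      change inner ℂ (T (T.adjoint (T v) - v)) (T v) = inner ℂ (T.adjoint (T v) - v) v at this
      rw [← LinearMap.adjoint_inner_right, ← sub_eq_zero, ← inner_sub_right] at this
      exact sub_eq_zero.1 (inner_self_eq_zero.1 this)
    obtain ⟨u, hu, v, hv, rfl⟩ := (LinearMap.ker T).exists_add_mem_mem_orthogonal f
    rw [map_add, LinearMap.mem_ker.1 hu, zero_add, key v hv]
  · intro h f hf
    have h1 : T.adjoint (T f) = f := by
      refine sub_eq_zero.1 (hdisj _ ?_ (Submodule.sub_mem _ (hadj _) hf))
      rw [LinearMap.mem_ker, map_sub, h, sub_self]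
    have h2 : inner ℂ (T f) (T f) = inner ℂ f f := by
      rw [← LinearMap.adjoint_inner_right, h1]
    rw [inner_self_eq_norm_sq_to_K, inner_self_eq_norm_sq_to_K] at h2
    have h3 : ‖T f‖ ^ 2 = ‖f‖ ^ 2 := by exact_mod_cast h2
    exact (sq_eq_sq₀ (norm_nonneg _) (norm_nonneg _)).1 h3

lemma unitary_conj_triple {V : Matrix (Fin m) (Fin m) ℂ} {W : Matrix (Fin n) (Fin n) ℂ}
    (hV : V ∈ Matrix.unitaryGroup (Fin m) ℂ) (hW : W ∈ Matrix.unitaryGroup (Fin n) ℂ)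
    (D : Matrix (Fin m) (Fin n) ℂ) :
    V * D * Wᴴ * (V * D * Wᴴ)ᴴ * (V * D * Wᴴ) = V * (D * Dᴴ * D) * Wᴴ := by
  simp only [Matrix.conjTranspose_mul, Matrix.conjTranspose_conjTranspose, Matrix.mul_assoc]
  rw [← Matrix.mul_assoc Wᴴ W, unitary_conjTranspose_mul_self hW, Matrix.one_mul,
    ← Matrix.mul_assoc Vᴴ V, unitary_conjTranspose_mul_self hV, Matrix.one_mul]

lemma unitary_conj_cancel {V : Matrix (Fin m) (Fin m) ℂ} {W : Matrix (Fin n) (Fin n) ℂ}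
    (hV : V ∈ Matrix.unitaryGroup (Fin m) ℂ) (hW : W ∈ Matrix.unitaryGroup (Fin n) ℂ)
    (D : Matrix (Fin m) (Fin n) ℂ) : Vᴴ * (V * D * Wᴴ) * W = D := by
  simp only [Matrix.mul_assoc]
  rw [unitary_conjTranspose_mul_self hW, Matrix.mul_one, ← Matrix.mul_assoc,
    unitary_conjTranspose_mul_self hV, Matrix.one_mul]

lemma unitary_conj_injective {V : Matrix (Fin m) (Fin m) ℂ} {W : Matrix (Fin n) (Fin n) ℂ}
    (hV : V ∈ Matrix.unitaryGroup (Fin m) ℂ) (hW : W ∈ Matrix.unitaryGroup (Fin n) ℂ)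
    {D D' : Matrix (Fin m) (Fin n) ℂ} (h : V * D * Wᴴ = V * D' * Wᴴ) : D = D' := by
  rw [← unitary_conj_cancel hV hW D, h, unitary_conj_cancel hV hW]

/-- The singular values of a partial isometry are `1, …, 1, 0, …, 0`. -/
lemma singVal_succ_of_isPartialIsometry {X : Matrix (Fin m) (Fin n) ℂ}
    (hX : X * Xᴴ * X = X) (i : ℕ) :
    singVal X (i + 1) = if i < X.rank then 1 else 0 := by
  split_ifs with hi
  · obtain ⟨V, W, hV, hW, hs⟩ := exists_isSVD X
    -- In SVD coordinates `X X* X = X` reads `s³ = s` for each singular value, so a nonzero one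
    -- equals `1`.
    have h1 : V * (sigma X * (sigma X)ᴴ * sigma X) * Wᴴ = V * sigma X * Wᴴ := by
      rw [← unitary_conj_triple hV hW, ← hs, hX]
    have h2 := unitary_conj_injective hV hW h1
    rw [sigma_eq_rectDiag, rectDiag_conjTranspose, rectDiag_mul, rectDiag_mul] at h2
    have him : i < m := hi.trans_le X.rank_le_height
    have hin : i < n := hi.trans_le X.rank_le_width
    have h3 := congrFun (congrFun h2 ⟨i, him⟩) ⟨i, hin⟩
    simp only [rectDiag_apply, if_true, him, hin, ← starRingEnd_apply, Complex.conj_ofReal] at h3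
    have h4 : singVal X (i + 1) * singVal X (i + 1) * singVal X (i + 1) = singVal X (i + 1) := by
      exact_mod_cast h3
    have hpos := (singVal_succ_pos_iff X i).2 hi
    have h5 : singVal X (i + 1) * singVal X (i + 1) = 1 :=
      mul_right_cancel₀ hpos.ne' (h4.trans (one_mul _).symm)
    nlinarith
  · exact (singVal_succ_eq_zero_iff X i).2 (not_lt.1 hi)

lemma sum_indicator_lt {q k : ℕ} (hk : k ≤ q) (f : ℕ → ℝ) :
    ∑ i : Fin q, (if i.val < k then f i else 0) = ∑ i ∈ Finset.range k, f i := by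
  rw [← Finset.sum_range fun i => if i < k then f i else 0, ← Finset.sum_filter]
  congr 1
  ext i
  simp only [Finset.mem_filter, Finset.mem_range]
  omega

lemma trace_conjTranspose_mul_self_of_isPartialIsometry {X : Matrix (Fin m) (Fin n) ℂ}
    (hX : X * Xᴴ * X = X) : (Xᴴ * X).trace = X.rank := by
  rw [trace_conjTranspose_mul_self]
  have : ∀ i : Fin (min m n), singVal X (i.val + 1) ^ 2 = if i.val < X.rank then (1 : ℝ) else 0 :=
    fun i => by
      rw [singVal_succ_of_isPartialIsometry hX]
      split_ifs <;> simp
  rw [Finset.sum_congr rfl fun i _ => this i, sum_indicator_lt (rank_le_min X) fun _ => 1]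
  simp

/-- Once the singular values are known to be `0` or `1`, the trace of `X* X` counts the ones; rank
becomes an expression that is easy to follow through block decompositions. -/
lemma mem_partialIsometries_iff {X : Matrix (Fin m) (Fin n) ℂ} {k : ℕ} :
    X ∈ partialIsometries m n k ↔ X * Xᴴ * X = X ∧ (Xᴴ * X).trace = k := by
  change IsPartialIsometry X ∧ X.rank = k ↔ _
  rw [isPartialIsometry_iff]
  refine and_congr_right fun hX => ?_
  rw [trace_conjTranspose_mul_self_of_isPartialIsometry hX, Nat.cast_inj]

end PartialIsometry

/-! ### The minimum value and the trace identity for minimizers -/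

section Optimal

variable {m n : ℕ}

/-- The nonincreasingly ordered singular values of `F` minus those of a partial isometry of
rank `k`. -/
def gapVector (F : Matrix (Fin m) (Fin n) ℂ) (k : ℕ) : Fin (min m n) → ℝ :=
  fun i => singVal F (i.val + 1) - if i.val < k then 1 else 0

/-- The equality clause is the passage to the Frobenius norm: equal sums of squares for the gap
vector and for `s(F - X)` leave, after cancelling `‖F‖²` and `k`, only the cross terms. -/
lemma gauge_gapVector_le {Φ : Seminorm ℝ (Fin (min m n) → ℝ)} (hΦ : IsSymmetricGauge Φ)
    (hconv : IsStrictlyConvex Φ) {k : ℕ} (F : Matrix (Fin m) (Fin n) ℂ)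
    {X : Matrix (Fin m) (Fin n) ℂ} (hX : X ∈ partialIsometries m n k) :
    Φ (gapVector F k) ≤ gaugeNorm Φ (F - X) ∧
      (Φ (gapVector F k) = gaugeNorm Φ (F - X) →
        (Fᴴ * X).trace.re = ∑ i ∈ Finset.range k, singVal F (i + 1)) := by
  have hXr : X.rank = k := hX.2
  have hXP := (mem_partialIsometries_iff.1 hX).1
  have hXs := singVal_succ_of_isPartialIsometry hXP
  have hkq : k ≤ min m n := hXr ▸ rank_le_min X
  have hmaj := gauge_le_of_majorized hΦ hconv (w := gapVector F k)
    (g := fun i => singVal (F - X) (i + 1)) fun I => by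
      have := sum_abs_singVal_sub_le F X I
      simpa [gapVector, hXs, hXr] using this
  refine ⟨hmaj.1, fun h => ?_⟩
  have hsq := hmaj.2 h
  have h1 := trace_conjTranspose_mul_self (F - X)
  rw [← hsq, Matrix.conjTranspose_sub, Matrix.sub_mul, Matrix.mul_sub, Matrix.mul_sub,
    Matrix.trace_sub, Matrix.trace_sub, Matrix.trace_sub, (mem_partialIsometries_iff.1 hX).2,
    trace_conjTranspose_mul_self F] at h1
  have h2 : (Xᴴ * F).trace = star (Fᴴ * X).trace := by
    rw [← Matrix.trace_conjTranspose, Matrix.conjTranspose_mul, Matrix.conjTranspose_conjTranspose]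
  have h3 := congrArg Complex.re h1
  rw [h2] at h3
  simp only [Complex.sub_re, Complex.ofReal_re, Complex.natCast_re, ← starRingEnd_apply,
    Complex.conj_re] at h3
  have h4 : ∑ i, gapVector F k i ^ 2 = ∑ i : Fin (min m n), singVal F (i.val + 1) ^ 2 -
      2 * ∑ i ∈ Finset.range k, singVal F (i + 1) + k := by
    have h5 : ∀ i : Fin (min m n), gapVector F k i ^ 2 = singVal F (i.val + 1) ^ 2 -
        2 * (if i.val < k then singVal F (i.val + 1) else 0) + if i.val < k then 1 else 0 := by
      intro i
      simp only [gapVector]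
      split_ifs <;> ring
    rw [Finset.sum_congr rfl fun i _ => h5 i, Finset.sum_add_distrib, Finset.sum_sub_distrib,
      ← Finset.mul_sum, sum_indicator_lt hkq fun i => singVal F (i + 1),
      sum_indicator_lt hkq fun _ => 1]
    simp
  linarith

/-- The rectangular diagonal matrix with `k` leading ones. -/
def leadingOnes (m n k : ℕ) : Matrix (Fin m) (Fin n) ℂ :=
  rectDiag m n fun i => if i < k then 1 else 0

lemma leadingOnes_triple (k : ℕ) :
    leadingOnes m n k * (leadingOnes m n k)ᴴ * leadingOnes m n k = leadingOnes m n k := by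
  rw [leadingOnes, rectDiag_conjTranspose, rectDiag_mul, rectDiag_mul]
  refine rectDiag_congr fun i hi hi' => ?_
  simp only [hi, hi', if_true]
  split_ifs <;> simp

lemma leadingOnes_mem {k : ℕ} (hk : k ≤ min m n) {V : Matrix (Fin m) (Fin m) ℂ}
    {W : Matrix (Fin n) (Fin n) ℂ}
    (hV : V ∈ Matrix.unitaryGroup (Fin m) ℂ) (hW : W ∈ Matrix.unitaryGroup (Fin n) ℂ) :
    V * leadingOnes m n k * Wᴴ ∈ partialIsometries m n k := by
  rw [mem_partialIsometries_iff]
  constructor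
  · rw [unitary_conj_triple hV hW, leadingOnes_triple]
  · rw [leadingOnes, sum_sq_singVal_of_eq hV hW rfl, ← Complex.ofReal_sum]
    have : ∀ i : Fin (min m n), ‖(if i.val < k then (1 : ℂ) else 0)‖ ^ 2 =
        if i.val < k then (1 : ℝ) else 0 := fun i => by split_ifs <;> simp
    rw [Finset.sum_congr rfl fun i _ => this i, sum_indicator_lt hk fun _ => 1]
    simp

/-- `X` and `F` have a common singular value decomposition, where `X` has `k` leading singular
values `1` and the others `0`. -/
def IsAligned (k : ℕ) (F X : Matrix (Fin m) (Fin n) ℂ) : Prop :=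
  ∃ V W, IsSVD F V W ∧ X = V * leadingOnes m n k * Wᴴ

lemma gaugeNorm_sub_of_isAligned {Φ : Seminorm ℝ (Fin (min m n) → ℝ)} (hΦ : IsSymmetricGauge Φ)
    {k : ℕ} {F X : Matrix (Fin m) (Fin n) ℂ} (h : IsAligned k F X) :
    gaugeNorm Φ (F - X) = Φ (gapVector F k) := by
  obtain ⟨V, W, ⟨hV, hW, hF⟩, hX⟩ := h
  have : F - X = V * rectDiag m n (fun i =>
      ((singVal F (i + 1) - if i < k then 1 else 0 : ℝ) : ℂ)) * Wᴴ := by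
    conv_lhs => rw [hF, hX]
    rw [← Matrix.sub_mul, ← Matrix.mul_sub, sigma_eq_rectDiag, leadingOnes, rectDiag_sub]
    congr 2
    refine rectDiag_congr fun i _ _ => ?_
    split_ifs <;> simp
  rw [gaugeNorm_of_eq hΦ hV hW this]
  rfl

lemma mem_minimizers_of_isAligned {Φ : Seminorm ℝ (Fin (min m n) → ℝ)} (hΦ : IsSymmetricGauge Φ)
    (hconv : IsStrictlyConvex Φ) {k : ℕ} (hk : k ≤ min m n) {F X : Matrix (Fin m) (Fin n) ℂ}
    (h : IsAligned k F X) : X ∈ minimizers Φ k F := by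
  refine ⟨?_, fun Y hY => ?_⟩
  · obtain ⟨V, W, ⟨hV, hW, -⟩, rfl⟩ := h
    exact leadingOnes_mem hk hV hW
  · rw [gaugeNorm_sub_of_isAligned hΦ h]
    exact (gauge_gapVector_le hΦ hconv F hY).1

/-- Comparison with one aligned competitor shows that a minimizer attains the lower bound, so the
equality clause of `gauge_gapVector_le` applies. -/
lemma re_trace_of_mem_minimizers {Φ : Seminorm ℝ (Fin (min m n) → ℝ)} (hΦ : IsSymmetricGauge Φ)
    (hconv : IsStrictlyConvex Φ) {k : ℕ} (hk : k ≤ min m n) {F X : Matrix (Fin m) (Fin n) ℂ}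
    (hX : X ∈ minimizers Φ k F) :
    (Fᴴ * X).trace.re = ∑ i ∈ Finset.range k, singVal F (i + 1) := by
  obtain ⟨V, W, h⟩ := exists_isSVD F
  have hal : IsAligned k F (V * leadingOnes m n k * Wᴴ) := ⟨V, W, h, rfl⟩
  have h1 := hX.2 _ (leadingOnes_mem hk h.1 h.2.1)
  rw [gaugeNorm_sub_of_isAligned hΦ hal] at h1
  have h2 := gauge_gapVector_le hΦ hconv F hX.1
  exact h2.2 (le_antisymm h2.1 h1)

end Optimal

/-! ### Block diagonal matrices and unitaries acting on a block -/

section Block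

variable {m n l a b : ℕ}

/-- The inclusion of `ℂ^a` as the coordinates `l, …, l + a - 1` of `ℂ^m`. -/
def incl (m l a : ℕ) : Matrix (Fin m) (Fin a) ℂ :=
  Matrix.of fun i j => if i.val = l + j.val then 1 else 0

lemma incl_apply (i : Fin m) (j : Fin a) :
    incl m l a i j = if i.val = l + j.val then 1 else 0 := rfl

lemma mul_incl_apply {ι : Type*} (h : l + a ≤ m) (M : Matrix ι (Fin m) ℂ) (i : ι) (j : Fin a) :
    (M * incl m l a) i j = M i ⟨l + j.val, by omega⟩ := by
  rw [Matrix.mul_apply, Finset.sum_eq_single (⟨l + j.val, by omega⟩ : Fin m)]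
  · simp [incl_apply]
  · intro x _ hx
    rw [incl_apply, if_neg (fun h => hx (Fin.ext h)), mul_zero]
  · simp

lemma conjTranspose_incl_mul_apply {ι : Type*} (h : l + a ≤ m) (M : Matrix (Fin m) ι ℂ)
    (i : Fin a) (j : ι) :
    ((incl m l a)ᴴ * M) i j = M ⟨l + i.val, by omega⟩ j := by
  have := mul_incl_apply h Mᴴ j i
  rw [← Matrix.conjTranspose_conjTranspose M, ← Matrix.conjTranspose_mul,
    Matrix.conjTranspose_apply, this]
  simp

lemma incl_conjTranspose_mul_self (h : l + a ≤ m) : (incl m l a)ᴴ * incl m l a = 1 := by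
  ext i j
  rw [mul_incl_apply h, Matrix.conjTranspose_apply, incl_apply, Matrix.one_apply]
  by_cases hij : i = j
  · simp [hij]
  · have : ¬ l + j.val = l + i.val := fun h => hij (Fin.ext (by omega))
    simp [hij, Ne.symm (fun h => this (by omega) : (i : ℕ) ≠ j)]

lemma leadingOnes_mul_incl (h : l + b ≤ n) : leadingOnes m n l * incl n l b = 0 := by
  ext i j
  rw [mul_incl_apply h, leadingOnes, rectDiag_apply]
  split_ifs with h1 h2
  · simp only at h1; omega
  · rfl
  · rfl

lemma conjTranspose_incl_mul_leadingOnes (h : l + a ≤ m) :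
    (incl m l a)ᴴ * leadingOnes m n l = 0 := by
  ext i j
  rw [conjTranspose_incl_mul_apply h, leadingOnes, rectDiag_apply]
  simp

lemma leadingOnes_conjTranspose (k : ℕ) : (leadingOnes m n k)ᴴ = leadingOnes n m k := by
  rw [leadingOnes, rectDiag_conjTranspose, leadingOnes]
  refine rectDiag_congr fun i _ _ => ?_
  split_ifs <;> simp

lemma blockDiag_eq (A : Matrix (Fin a) (Fin b) ℂ) :
    blockDiag m n l A = leadingOnes m n l + incl m l a * A * (incl n l b)ᴴ := by
  have hz : ∀ (i : Fin m) (j : Fin n), ¬(l ≤ i.val ∧ i.val < l + a) →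
      (incl m l a * A * (incl n l b)ᴴ) i j = 0 := by
    intro i j hi
    rw [Matrix.mul_assoc, Matrix.mul_apply]
    refine Finset.sum_eq_zero fun x _ => ?_
    rw [incl_apply, if_neg (fun h => hi (by omega)), zero_mul]
  have hz' : ∀ (i : Fin m) (j : Fin n), ¬(l ≤ j.val ∧ j.val < l + b) →
      (incl m l a * A * (incl n l b)ᴴ) i j = 0 := by
    intro i j hj
    rw [Matrix.mul_apply]
    refine Finset.sum_eq_zero fun x _ => ?_
    rw [Matrix.conjTranspose_apply, incl_apply, if_neg (fun h => hj (by omega)), star_zero,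
      mul_zero]
  ext i j
  rw [Matrix.add_apply]
  simp only [blockDiag, Matrix.of_apply]
  split_ifs with h h2
  · obtain ⟨⟨h1, h2⟩, h3, h4⟩ := h
    have e1 : (leadingOnes m n l) i j = 0 := by
      rw [leadingOnes, rectDiag_apply]
      split_ifs
      · omega
      · rfl
      · rfl
    rw [e1, zero_add, Matrix.mul_apply, Finset.sum_eq_single (⟨j.val - l, by omega⟩ : Fin b)]
    · rw [Matrix.mul_apply, Finset.sum_eq_single (⟨i.val - l, by omega⟩ : Fin a)]
      · simp [incl_apply, h1, h3]
      · intro x _ hx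
        rw [incl_apply, if_neg (fun h => hx (Fin.ext (by simp; omega))), zero_mul]
      · simp
    · intro x _ hx
      rw [Matrix.conjTranspose_apply, incl_apply,
        if_neg (fun h => hx (Fin.ext (by simp; omega))), star_zero, mul_zero]
    · simp
  · have e1 : (leadingOnes m n l) i j = 1 := by
      rw [leadingOnes, rectDiag_apply, if_pos h2.1, if_pos h2.2]
    rw [e1, hz i j (by omega), add_zero]
  · have e1 : (leadingOnes m n l) i j = 0 := by
      rw [leadingOnes, rectDiag_apply]
      split_ifs
      · omega
      · rfl
      · rfl
    rw [e1, zero_add]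
    by_cases h3 : l ≤ i.val ∧ i.val < l + a
    · exact (hz' i j fun h4 => h ⟨h3, h4⟩).symm
    · exact (hz i j h3).symm

lemma compress_blockDiag (hm : l + a ≤ m) (hn : l + b ≤ n) (A : Matrix (Fin a) (Fin b) ℂ) :
    (incl m l a)ᴴ * blockDiag m n l A * incl n l b = A := by
  rw [blockDiag_eq, Matrix.mul_add, conjTranspose_incl_mul_leadingOnes hm, zero_add]
  simp only [Matrix.mul_assoc]
  rw [incl_conjTranspose_mul_self hn, Matrix.mul_one, ← Matrix.mul_assoc,
    incl_conjTranspose_mul_self hm, Matrix.one_mul]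

lemma blockDiag_injective (hm : l + a ≤ m) (hn : l + b ≤ n) :
    Function.Injective fun A : Matrix (Fin a) (Fin b) ℂ => blockDiag m n l A := fun A B h => by
  rw [← compress_blockDiag hm hn A, ← compress_blockDiag hm hn B]
  simp only at h
  rw [h]

lemma blockDiag_conjTranspose (A : Matrix (Fin a) (Fin b) ℂ) :
    (blockDiag m n l A)ᴴ = blockDiag n m l Aᴴ := by
  rw [blockDiag_eq, blockDiag_eq, Matrix.conjTranspose_add, leadingOnes_conjTranspose]
  simp [Matrix.conjTranspose_mul, Matrix.mul_assoc]

lemma leadingOnes_mul_leadingOnes {p : ℕ} (h : l ≤ n) :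
    leadingOnes m n l * leadingOnes n p l = leadingOnes m p l := by
  rw [leadingOnes, leadingOnes, rectDiag_mul]
  refine rectDiag_congr fun i _ _ => ?_
  by_cases hi : i < l
  · simp [hi, hi.trans_le h]
  · simp [hi]

lemma blockDiag_mul {p c : ℕ} (hn : l + b ≤ n)
    (A : Matrix (Fin a) (Fin b) ℂ) (B : Matrix (Fin b) (Fin c) ℂ) :
    blockDiag m n l A * blockDiag n p l B = blockDiag m p l (A * B) := by
  have h1 : leadingOnes m n l * (incl n l b * B * (incl p l c)ᴴ) = 0 := by
    rw [Matrix.mul_assoc, ← Matrix.mul_assoc, leadingOnes_mul_incl hn, Matrix.zero_mul]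
  have h2 : incl m l a * A * (incl n l b)ᴴ * leadingOnes n p l = 0 := by
    rw [Matrix.mul_assoc, conjTranspose_incl_mul_leadingOnes hn, Matrix.mul_zero]
  have h3 : incl m l a * A * (incl n l b)ᴴ * (incl n l b * B * (incl p l c)ᴴ) =
      incl m l a * (A * B) * (incl p l c)ᴴ := by
    simp only [Matrix.mul_assoc]
    rw [← Matrix.mul_assoc (incl n l b)ᴴ, incl_conjTranspose_mul_self hn, Matrix.one_mul]
  rw [blockDiag_eq, blockDiag_eq, blockDiag_eq, Matrix.add_mul, Matrix.mul_add,
    Matrix.mul_add, h1, h2, h3, leadingOnes_mul_leadingOnes (by omega), add_zero, zero_add]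

lemma trace_leadingOnes (h : l ≤ m) : (leadingOnes m m l).trace = l := by
  rw [leadingOnes, rectDiag_self, Matrix.trace_diagonal,
    ← Finset.sum_range fun i => if i < l then (1 : ℂ) else 0, ← Finset.sum_filter]
  have : (Finset.range m).filter (fun i => i < l) = Finset.range l := by
    ext i; simp only [Finset.mem_filter, Finset.mem_range]; omega
  rw [this]
  simp

lemma trace_blockDiag (hm : l + a ≤ m) (A : Matrix (Fin a) (Fin a) ℂ) :
    (blockDiag m m l A).trace = l + A.trace := by
  rw [blockDiag_eq, Matrix.trace_add, trace_leadingOnes (by omega), Matrix.mul_assoc,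
    Matrix.trace_mul_comm, Matrix.mul_assoc, incl_conjTranspose_mul_self hm, Matrix.mul_one]

lemma blockDiag_mem_partialIsometries_iff (hm : l + a ≤ m) (hn : l + b ≤ n) {p : ℕ}
    (A : Matrix (Fin a) (Fin b) ℂ) :
    blockDiag m n l A ∈ partialIsometries m n (l + p) ↔ A ∈ partialIsometries a b p := by
  rw [mem_partialIsometries_iff, mem_partialIsometries_iff, blockDiag_conjTranspose,
    blockDiag_mul hn, blockDiag_mul hm, blockDiag_mul hm, trace_blockDiag hn,
    (blockDiag_injective hm hn).eq_iff]
  push_cast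
  rw [add_right_inj]

lemma blockDiag_leadingOnes {p : ℕ} (hp : p ≤ min a b) :
    blockDiag m n l (leadingOnes a b p) = leadingOnes m n (l + p) := by
  ext i j
  simp only [blockDiag, leadingOnes, rectDiag_apply, Matrix.of_apply]
  split_ifs <;> first | rfl | omega

/-- The unitary matrix acting as `Q` on the coordinates `l, …, l + a - 1`. -/
def embed (m l : ℕ) {a : ℕ} (Q : Matrix (Fin a) (Fin a) ℂ) : Matrix (Fin m) (Fin m) ℂ :=
  1 - incl m l a * (incl m l a)ᴴ + incl m l a * Q * (incl m l a)ᴴ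

lemma embed_mul_incl (hm : l + a ≤ m) (Q : Matrix (Fin a) (Fin a) ℂ) :
    embed m l Q * incl m l a = incl m l a * Q := by
  rw [embed, Matrix.add_mul, Matrix.sub_mul, Matrix.mul_assoc, Matrix.mul_assoc,
    incl_conjTranspose_mul_self hm]
  simp

lemma embed_conjTranspose (Q : Matrix (Fin a) (Fin a) ℂ) :
    (embed m l Q)ᴴ = embed m l Qᴴ := by
  simp [embed, Matrix.conjTranspose_mul, Matrix.mul_assoc]

lemma embed_mem_unitaryGroup (hm : l + a ≤ m) {Q : Matrix (Fin a) (Fin a) ℂ}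
    (hQ : Q ∈ Matrix.unitaryGroup (Fin a) ℂ) : embed m l Q ∈ Matrix.unitaryGroup (Fin m) ℂ := by
  apply unitary_of_conjTranspose_mul_self
  rw [embed_conjTranspose]
  conv_lhs => rw [embed.eq_def m l Q]
  have h1 : incl m l a * Qᴴ * (Q * (incl m l a)ᴴ) = incl m l a * (incl m l a)ᴴ := by
    rw [Matrix.mul_assoc, ← Matrix.mul_assoc Qᴴ, unitary_conjTranspose_mul_self hQ,
      Matrix.one_mul]
  rw [Matrix.mul_add, Matrix.mul_sub, Matrix.mul_one, Matrix.mul_assoc (incl m l a) Q,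
    ← Matrix.mul_assoc, ← Matrix.mul_assoc, embed_mul_incl hm, h1, embed]
  abel

lemma embed_mul_leadingOnes (hm : l + a ≤ m) (Q : Matrix (Fin a) (Fin a) ℂ) :
    embed m l Q * leadingOnes m n l = leadingOnes m n l := by
  rw [embed, Matrix.add_mul, Matrix.sub_mul, Matrix.mul_assoc, Matrix.mul_assoc,
    conjTranspose_incl_mul_leadingOnes hm]
  simp

lemma blockDiag_mul_mul (hm : l + a ≤ m) (hn : l + b ≤ n) (A : Matrix (Fin a) (Fin a) ℂ)
    (D : Matrix (Fin a) (Fin b) ℂ) (B : Matrix (Fin b) (Fin b) ℂ) :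
    blockDiag m n l (A * D * Bᴴ) = embed m l A * blockDiag m n l D * (embed n l B)ᴴ := by
  have h1 : leadingOnes m n l * (embed n l B)ᴴ = leadingOnes m n l := by
    rw [← leadingOnes_conjTranspose (m := n), ← Matrix.conjTranspose_mul, embed_mul_leadingOnes hn]
  have h2 : (incl n l b)ᴴ * (embed n l B)ᴴ = Bᴴ * (incl n l b)ᴴ := by
    rw [← Matrix.conjTranspose_mul, embed_mul_incl hn, Matrix.conjTranspose_mul]
  rw [blockDiag_eq, blockDiag_eq, Matrix.mul_add, Matrix.add_mul,
    embed_mul_leadingOnes hm, h1]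
  simp only [Matrix.mul_assoc]
  rw [h2, ← Matrix.mul_assoc (embed m l A), embed_mul_incl hm]
  simp only [Matrix.mul_assoc]

/-- Where `M` is a scalar on the block, it intertwines the two copies of `Q`. This is the freedom in
the SVD at a repeated singular value, with the same unitary forced on both sides. -/
lemma embed_conj_of_scalar (hn : l + a ≤ n) {Q : Matrix (Fin a) (Fin a) ℂ}
    (hQ : Q ∈ Matrix.unitaryGroup (Fin a) ℂ) {M : Matrix (Fin m) (Fin n) ℂ} {c : ℂ}
    (h1 : M * incl n l a = c • incl m l a) (h2 : (incl m l a)ᴴ * M = c • (incl n l a)ᴴ) :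
    embed m l Q * M * (embed n l Q)ᴴ = M := by
  have : embed m l Q * M = M * embed n l Q := by
    simp only [embed, Matrix.add_mul, Matrix.sub_mul, Matrix.mul_add, Matrix.mul_sub,
      Matrix.mul_one, Matrix.one_mul, Matrix.mul_assoc, h2]
    simp only [← Matrix.mul_assoc, h1]
    simp
  rw [this, Matrix.mul_assoc, unitary_mul_conjTranspose_self (embed_mem_unitaryGroup hn hQ),
    Matrix.mul_one]

/-- Where `M` vanishes on the block, the unitaries on the two sides may be chosen independently;
this is the extra freedom at the singular value `0`. -/
lemma embed_conj_of_zero (A : Matrix (Fin a) (Fin a) ℂ)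
    (B : Matrix (Fin b) (Fin b) ℂ) {M : Matrix (Fin m) (Fin n) ℂ}
    (h1 : M * incl n l b = 0) (h2 : (incl m l a)ᴴ * M = 0) :
    embed m l A * M * (embed n l B)ᴴ = M := by
  have e1 : embed m l A * M = M := by
    simp only [embed, Matrix.add_mul, Matrix.sub_mul, Matrix.one_mul, Matrix.mul_assoc, h2]
    simp
  rw [e1, embed_conjTranspose]
  simp only [embed, Matrix.mul_add, Matrix.mul_sub, Matrix.mul_one, ← Matrix.mul_assoc, h1]
  simp

end Block

/-! ### Projections and partial isometries as blocks of aligned matrices -/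

section Align

variable {m n : ℕ}

lemma isStarProjection_iff_of_matrix {e : ℕ} (P : Matrix (Fin e) (Fin e) ℂ) :
    IsStarProjection P ↔ P * Pᴴ = P := by
  constructor
  · intro h
    have h1 : Pᴴ = P := h.isSelfAdjoint
    rw [h1]
    exact h.isIdempotentElem
  · intro h
    have h1 : Pᴴ = P := by
      have := congrArg Matrix.conjTranspose h
      rw [Matrix.conjTranspose_mul, Matrix.conjTranspose_conjTranspose, h] at this
      exact this.symm
    exact ⟨by rw [h1] at h; exact h, h1⟩

lemma mem_partialIsometries_of_isStarProjection {e p : ℕ} {P : Matrix (Fin e) (Fin e) ℂ}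
    (hP : IsStarProjection P) : P ∈ partialIsometries e e p ↔ P.rank = p := by
  have h := (isStarProjection_iff_of_matrix P).1 hP
  refine ⟨fun h => h.2, fun hr => ⟨(isPartialIsometry_iff P).2 ?_, hr⟩⟩
  rw [h]
  exact hP.isIdempotentElem

lemma rank_eq_iff_trace_of_isStarProjection {e p : ℕ} {P : Matrix (Fin e) (Fin e) ℂ}
    (hP : IsStarProjection P) : P.rank = p ↔ P.trace = p := by
  have h := (isStarProjection_iff_of_matrix P).1 hP
  have h1 : Pᴴ = P := hP.isSelfAdjoint
  rw [← mem_partialIsometries_of_isStarProjection hP, mem_partialIsometries_iff, h]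
  rw [h1] at h ⊢
  simp [h]

/-- Unitary diagonalization of an orthogonal projection. -/
lemma exists_diagonalization_of_isStarProjection {e : ℕ} {P : Matrix (Fin e) (Fin e) ℂ}
    (hP : IsStarProjection P) :
    ∃ Q ∈ Matrix.unitaryGroup (Fin e) ℂ, P = Q * leadingOnes e e P.rank * Qᴴ := by
  have hH : P.IsHermitian := hP.isSelfAdjoint
  obtain ⟨Q, hQ, d, hd, hPd⟩ := exists_sorted_diagonalization (Equiv.refl (Fin e)) hH
  have hd' : Antitone d := hd
  refine ⟨Q, hQ, ?_⟩
  have hidem : ∀ i, d i = 0 ∨ d i = 1 := by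
    have h1 : P * P = P := hP.isIdempotentElem
    have hcancel : ∀ M : Matrix (Fin e) (Fin e) ℂ, Qᴴ * (Q * M * Qᴴ) * Q = M :=
      unitary_conj_cancel hQ hQ
    have h2 : Qᴴ * (P * P) * Q =
        Matrix.diagonal (fun i => (d i : ℂ)) * Matrix.diagonal (fun i => (d i : ℂ)) := by
      have : P * P = Q * (Matrix.diagonal (fun i => (d i : ℂ)) *
          Matrix.diagonal (fun i => (d i : ℂ))) * Qᴴ := by
        conv_lhs => rw [hPd]
        simp only [Matrix.mul_assoc]
        rw [← Matrix.mul_assoc Qᴴ, unitary_conjTranspose_mul_self hQ, Matrix.one_mul]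
      rw [this, hcancel]
    rw [h1, hPd, hcancel, Matrix.diagonal_mul_diagonal] at h2
    intro i
    have h3 : (d i : ℂ) = d i * d i := congrFun (Matrix.diagonal_injective h2) i
    have h4 : d i = d i * d i := by exact_mod_cast h3
    rcases mul_eq_zero.1 (show d i * (d i - 1) = 0 by linarith) with h | h
    · exact Or.inl h
    · exact Or.inr (by linarith)
  have hsum : ∑ i, d i = P.rank := by
    have h1 := (rank_eq_iff_trace_of_isStarProjection hP).1 rfl
    conv_lhs at h1 => rw [hPd]
    rw [trace_unitary_conj hQ, Matrix.trace_diagonal] at h1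
    exact_mod_cast h1
  have hnn : ∀ i, 0 ≤ d i := fun i => by rcases hidem i with h | h <;> simp [h]
  have hle : ∀ i, d i ≤ 1 := fun i => by rcases hidem i with h | h <;> simp [h]
  -- The eigenvalues are `0` or `1` and nonincreasing. A zero at `i` bounds their sum, the rank, by
  -- `i`; a one at `i` forces it to be at least `i + 1`.
  have hval : ∀ i : Fin e, d i = if i.val < P.rank then 1 else 0 := by
    intro i
    rcases hidem i with h | h
    · rw [if_neg, h]
      have h1 : ∑ j, d j ≤ ∑ j, if j < i then (1 : ℝ) else 0 := by
        refine Finset.sum_le_sum fun j _ => ?_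
        split_ifs with hj
        · exact hle j
        · exact (hd' (not_lt.1 hj)).trans h.le
      rw [hsum, Finset.sum_boole] at h1
      have h2 : (Finset.univ.filter fun j => j < i) = Finset.Iio i := by ext; simp
      rw [h2, Fin.card_Iio] at h1
      have h3 : P.rank ≤ i.val := by exact_mod_cast h1
      omega
    · rw [if_pos, h]
      have h1 : (∑ j, if j ≤ i then (1 : ℝ) else 0) ≤ ∑ j, d j := by
        refine Finset.sum_le_sum fun j _ => ?_
        split_ifs with hj
        · exact h.ge.trans (hd' hj)
        · exact hnn j
      rw [hsum, Finset.sum_boole] at h1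
      have h2 : (Finset.univ.filter fun j => j ≤ i) = Finset.Iic i := by ext; simp
      rw [h2, Fin.card_Iic] at h1
      have h3 : i.val + 1 ≤ P.rank := by exact_mod_cast h1
      omega
  conv_lhs => rw [hPd]
  rw [leadingOnes, rectDiag_self]
  congr 3
  ext i
  rw [hval i]
  split_ifs <;> simp

/-- Unitaries `A`, `B` that fix `Σ` turn `(V, W)` into another SVD, `(V A, W B)`, of the same `F`.
-/
lemma isAligned_of_isSVD_embed {F : Matrix (Fin m) (Fin n) ℂ} {V : Matrix (Fin m) (Fin m) ℂ}
    {W : Matrix (Fin n) (Fin n) ℂ} (h : IsSVD F V W) {k : ℕ} {A : Matrix (Fin m) (Fin m) ℂ}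
    {B : Matrix (Fin n) (Fin n) ℂ} (hA : A ∈ Matrix.unitaryGroup (Fin m) ℂ)
    (hB : B ∈ Matrix.unitaryGroup (Fin n) ℂ) (hF : A * sigma F * Bᴴ = sigma F) :
    IsAligned k F (V * (A * leadingOnes m n k * Bᴴ) * Wᴴ) := by
  refine ⟨V * A, W * B, ⟨mul_mem h.1 hA, mul_mem h.2.1 hB, ?_⟩, ?_⟩
  · rw [Matrix.conjTranspose_mul]
    calc F = V * sigma F * Wᴴ := h.2.2
      _ = V * (A * sigma F * Bᴴ) * Wᴴ := by rw [hF]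
      _ = _ := by simp only [Matrix.mul_assoc]
  · rw [Matrix.conjTranspose_mul]
    simp only [Matrix.mul_assoc]

lemma isAligned_projection {l e p : ℕ} (hm : l + e ≤ m) (hn : l + e ≤ n)
    {F : Matrix (Fin m) (Fin n) ℂ} {V : Matrix (Fin m) (Fin m) ℂ}
    {W : Matrix (Fin n) (Fin n) ℂ} (h : IsSVD F V W) {c : ℝ}
    (hc : ∀ i, l ≤ i → i < l + e → singVal F (i + 1) = c)
    {P : Matrix (Fin e) (Fin e) ℂ} (hP : IsStarProjection P) (hp : P.rank = p) :
    IsAligned (l + p) F (V * blockDiag m n l P * Wᴴ) := by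
  obtain ⟨Q, hQ, hPQ⟩ := exists_diagonalization_of_isStarProjection hP
  rw [hp] at hPQ
  have hpe : p ≤ min e e := by rw [← hp]; exact rank_le_min P
  rw [hPQ, blockDiag_mul_mul hm hn, blockDiag_leadingOnes hpe]
  refine isAligned_of_isSVD_embed h (embed_mem_unitaryGroup hm hQ) (embed_mem_unitaryGroup hn hQ)
    (embed_conj_of_scalar (c := (c : ℂ)) hn hQ ?_ ?_)
  · ext i j
    rw [mul_incl_apply hn, Matrix.smul_apply, sigma_eq_rectDiag, rectDiag_apply, incl_apply]
    simp only
    split_ifs with h1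
    · rw [hc i.val (by omega) (by omega)]; simp
    · simp
  · ext i j
    rw [conjTranspose_incl_mul_apply hm, Matrix.smul_apply, sigma_eq_rectDiag, rectDiag_apply,
      Matrix.conjTranspose_apply, incl_apply]
    simp only
    by_cases h1 : l + i.val = j.val
    · rw [if_pos h1, if_pos h1.symm, hc (l + i.val) (by omega) (by omega)]; simp
    · rw [if_neg h1, if_neg (Ne.symm h1)]; simp

lemma isAligned_partialIsometry {r p a b : ℕ} (hm : r + a ≤ m) (hn : r + b ≤ n)
    {F : Matrix (Fin m) (Fin n) ℂ} (hr : F.rank = r) {V : Matrix (Fin m) (Fin m) ℂ}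
    {W : Matrix (Fin n) (Fin n) ℂ} (h : IsSVD F V W)
    {S : Matrix (Fin a) (Fin b) ℂ} (hS : S ∈ partialIsometries a b p) :
    IsAligned (r + p) F (V * blockDiag m n r S * Wᴴ) := by
  obtain ⟨A, B, hA, hB, hAB⟩ := exists_isSVD S
  have hSr : S.rank = p := hS.2
  have hs : sigma S = leadingOnes a b p := by
    rw [sigma_eq_rectDiag, leadingOnes]
    refine rectDiag_congr fun i _ _ => ?_
    rw [singVal_succ_of_isPartialIsometry (mem_partialIsometries_iff.1 hS).1, hSr]
    split_ifs <;> simp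
  have hpe : p ≤ min a b := by rw [← hSr]; exact rank_le_min S
  rw [hAB, hs, blockDiag_mul_mul hm hn, blockDiag_leadingOnes hpe]
  have hz : ∀ i, r ≤ i → singVal F (i + 1) = 0 := fun i hi =>
    (singVal_succ_eq_zero_iff F i).2 (hr ▸ hi)
  refine isAligned_of_isSVD_embed h (embed_mem_unitaryGroup hm hA) (embed_mem_unitaryGroup hn hB)
    (embed_conj_of_zero A B ?_ ?_)
  · ext i j
    rw [mul_incl_apply hn, sigma_eq_rectDiag, rectDiag_apply]
    simp only
    split_ifs with h1
    · rw [hz i.val (by omega)]; simp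
    · simp
  · ext i j
    rw [conjTranspose_incl_mul_apply hm, sigma_eq_rectDiag, rectDiag_apply]
    simp only
    split_ifs with h1
    · rw [hz _ (by omega)]; simp
    · simp

end Align

/-! ### The equality case of the trace inequality -/

section Equality

lemma extremal_weights {q k : ℕ} (hk : 1 ≤ k) (hkq : k ≤ q) {s : ℕ → ℝ} (hs : Antitone s)
    (h0 : ∀ i, 0 ≤ s i) {d δ : Fin q → ℝ} (hd0 : ∀ i, 0 ≤ d i) (hd1 : ∀ i, d i ≤ 1)
    (hδ : ∀ i, 0 ≤ δ i) (hd : ∑ i, d i ≤ k)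
    (h : ∑ i : Fin q, s i * (d i - δ i) = ∑ i ∈ Finset.range k, s i) :
    (∀ i : Fin q, s i * δ i = 0) ∧ (∀ i : Fin q, s (k - 1) < s i → d i = 1) ∧
      (∀ i : Fin q, s i < s (k - 1) → d i = 0) ∧ (0 < s (k - 1) → ∑ i, d i = k) := by
  set τ := s (k - 1) with hτ
  set χ : Fin q → ℝ := fun i => if i.val < k then 1 else 0 with hχ
  have hχs : ∑ i, χ i = k := by
    rw [hχ, sum_indicator_lt hkq fun _ => 1]; simp
  have hχs' : ∑ i : Fin q, s i * χ i = ∑ i ∈ Finset.range k, s i := by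
    rw [← sum_indicator_lt hkq s]
    refine Finset.sum_congr rfl fun i _ => ?_
    simp [hχ]
  have hA : ∀ i : Fin q, 0 ≤ s i * δ i := fun i => mul_nonneg (h0 _) (hδ i)
  have hB : ∀ i : Fin q, 0 ≤ (s i - τ) * (χ i - d i) := fun i => by
    by_cases hi : i.val < k
    · simp only [hχ, hi, if_true]
      exact mul_nonneg (sub_nonneg.2 (hs (by omega))) (sub_nonneg.2 (hd1 i))
    · simp only [hχ, hi, if_false]
      exact mul_nonneg_of_nonpos_of_nonpos (sub_nonpos.2 (hs (by omega)))
        (by linarith [hd0 i])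
  have hC : 0 ≤ τ * (k - ∑ i, d i) := mul_nonneg (h0 _) (sub_nonneg.2 hd)
  -- The deficit from the maximum `s_1 + … + s_k` splits into three nonnegative terms, with `τ =
  -- s_k` as the dual multiplier of the constraint `∑ d ≤ k`. Equality makes each vanish, which is
  -- complementary slackness.
  have hsum : ∑ i : Fin q, s i * δ i + ∑ i : Fin q, (s i - τ) * (χ i - d i) +
      τ * (k - ∑ i, d i) = 0 := by
    have h1 : ∀ i : Fin q, s i * δ i + (s i - τ) * (χ i - d i) =
        s i * χ i - s i * (d i - δ i) - (τ * χ i - τ * d i) := fun i => by ring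
    rw [← Finset.sum_add_distrib, Finset.sum_congr rfl fun i _ => h1 i, Finset.sum_sub_distrib,
      Finset.sum_sub_distrib, Finset.sum_sub_distrib, ← Finset.mul_sum, ← Finset.mul_sum, h,
      hχs', hχs]
    ring
  have hAs := Finset.sum_nonneg fun i (_ : i ∈ Finset.univ) => hA i
  have hBs := Finset.sum_nonneg fun i (_ : i ∈ Finset.univ) => hB i
  have hA0 : ∀ i : Fin q, s i * δ i = 0 := fun i =>
    (Finset.sum_eq_zero_iff_of_nonneg fun i _ => hA i).1 (by linarith) i (Finset.mem_univ i)
  have hB0 : ∀ i : Fin q, (s i - τ) * (χ i - d i) = 0 := fun i =>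
    (Finset.sum_eq_zero_iff_of_nonneg fun i _ => hB i).1 (by linarith) i (Finset.mem_univ i)
  have hC0 : τ * (k - ∑ i, d i) = 0 := by linarith
  refine ⟨hA0, fun i hi => ?_, fun i hi => ?_, fun hτ0 => ?_⟩
  · have hik : i.val < k := by
      by_contra hcon
      exact absurd (hs (show k - 1 ≤ i.val by omega)) (not_le.2 hi)
    have := (mul_eq_zero.1 (hB0 i)).resolve_left (by linarith)
    simp only [hχ, hik, if_true] at this
    linarith
  · have hik : ¬ i.val < k := by
      intro hcon
      exact absurd (hs (show i.val ≤ k - 1 by omega)) (not_le.2 hi)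
    have := (mul_eq_zero.1 (hB0 i)).resolve_left (by linarith)
    simp only [hχ, hik, if_false] at this
    linarith
  · have := (mul_eq_zero.1 hC0).resolve_left hτ0.ne'
    linarith

lemma eq_single_of_sum_sq {ι : Type*} [Fintype ι] [DecidableEq ι] {v : ι → ℂ} {j₀ : ι}
    (h1 : ∑ j, ‖v j‖ ^ 2 = 1) (h2 : (v j₀).re = 1) (j : ι) : v j = if j = j₀ then 1 else 0 := by
  rw [← Finset.add_sum_erase _ _ (Finset.mem_univ j₀), Complex.sq_norm, Complex.normSq_apply,
    h2] at h1
  have h3 : 0 ≤ ∑ x ∈ Finset.univ.erase j₀, ‖v x‖ ^ 2 :=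
    Finset.sum_nonneg fun _ _ => sq_nonneg _
  have h4 := mul_self_nonneg (v j₀).im
  split_ifs with hj
  · subst hj
    have : (v j).im = 0 := mul_self_eq_zero.1 (by linarith)
    exact Complex.ext (by simp [h2]) (by simp [this])
  · have := (Finset.sum_eq_zero_iff_of_nonneg fun x _ => sq_nonneg ‖v x‖).1
      (show ∑ x ∈ Finset.univ.erase j₀, ‖v x‖ ^ 2 = 0 by linarith) j (by simp [hj])
    simpa using this

variable {m n : ℕ}

lemma mul_conjTranspose_self_apply_self (Y : Matrix (Fin m) (Fin n) ℂ) (i : Fin m) :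
    (Y * Yᴴ) i i = ((∑ j, ‖Y i j‖ ^ 2 : ℝ) : ℂ) := by
  rw [Matrix.mul_apply]
  push_cast
  refine Finset.sum_congr rfl fun j _ => ?_
  rw [Matrix.conjTranspose_apply, ← starRingEnd_apply, Complex.mul_conj']

lemma range_projection_idem {Y : Matrix (Fin m) (Fin n) ℂ} (hY : Y * Yᴴ * Y = Y) :
    (Y * Yᴴ)ᴴ * (Y * Yᴴ) = Y * Yᴴ := by
  rw [Matrix.conjTranspose_mul, Matrix.conjTranspose_conjTranspose, ← Matrix.mul_assoc, hY]

lemma sum_sq_range_projection {Y : Matrix (Fin m) (Fin n) ℂ} (hY : Y * Yᴴ * Y = Y)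
    (i : Fin m) : ∑ l, ‖(Y * Yᴴ) l i‖ ^ 2 = ∑ j, ‖Y i j‖ ^ 2 := by
  have h1 := mul_conjTranspose_self_apply_self ((Y * Yᴴ)ᴴ) i
  rw [Matrix.conjTranspose_conjTranspose, range_projection_idem hY,
    mul_conjTranspose_self_apply_self] at h1
  have h2 := Complex.ofReal_injective h1
  rw [h2]
  simp only [Matrix.conjTranspose_apply, norm_star]

/-- With `P = Y Y*` a projection, the squared norm `α` of the `i`-th row of `Y` is both `P_ii` and
the squared norm of the `i`-th column of `P`; hence `α² ≤ α`. -/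
lemma row_sum_sq_le_one {Y : Matrix (Fin m) (Fin n) ℂ} (hY : Y * Yᴴ * Y = Y) (i : Fin m) :
    ∑ j, ‖Y i j‖ ^ 2 ≤ 1 := by
  have h1 := sum_sq_range_projection hY i
  have h2 : ‖(Y * Yᴴ) i i‖ ^ 2 ≤ ∑ l, ‖(Y * Yᴴ) l i‖ ^ 2 :=
    Finset.single_le_sum (f := fun l => ‖(Y * Yᴴ) l i‖ ^ 2) (fun _ _ => sq_nonneg _)
      (Finset.mem_univ i)
  rw [h1, mul_conjTranspose_self_apply_self, Complex.norm_real, Real.norm_eq_abs, sq_abs] at h2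
  by_contra hcon
  nlinarith

lemma conjTranspose_triple {Y : Matrix (Fin m) (Fin n) ℂ} (hY : Y * Yᴴ * Y = Y) :
    Yᴴ * Yᴴᴴ * Yᴴ = Yᴴ := by
  have := congrArg Matrix.conjTranspose hY
  simpa [Matrix.conjTranspose_mul, Matrix.mul_assoc] using this

lemma col_sum_sq_le_one {Y : Matrix (Fin m) (Fin n) ℂ} (hY : Y * Yᴴ * Y = Y) (j : Fin n) :
    ∑ i, ‖Y i j‖ ^ 2 ≤ 1 := by
  have := row_sum_sq_le_one (conjTranspose_triple hY) j
  simpa only [Matrix.conjTranspose_apply, norm_star] using this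

/-- Expanding the square, the cross term is `Re Y_ij` because the projection `Y Y*` fixes the
columns of `Y`. This expresses `Re Y_ij` through row and column norms and a nonnegative defect. -/
lemma sum_sq_range_projection_sub {Y : Matrix (Fin m) (Fin n) ℂ} (hY : Y * Yᴴ * Y = Y)
    (i : Fin m) (j : Fin n) : ∑ l, ‖(Y * Yᴴ) l i - Y l j‖ ^ 2 =
      ∑ j, ‖Y i j‖ ^ 2 + ∑ i, ‖Y i j‖ ^ 2 - 2 * (Y i j).re := by
  have h1 : (Y i j).re = ∑ l, (Y l j * star ((Y * Yᴴ) l i)).re := by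
    have h2 : (Y * Yᴴ)ᴴ * Y = Y := by
      rw [Matrix.conjTranspose_mul, Matrix.conjTranspose_conjTranspose, hY]
    conv_lhs => rw [← h2]
    rw [Matrix.mul_apply, Complex.re_sum]
    refine Finset.sum_congr rfl fun l _ => ?_
    rw [Matrix.conjTranspose_apply, mul_comm]
  rw [← sum_sq_range_projection hY i, h1, Finset.mul_sum, ← Finset.sum_add_distrib,
    ← Finset.sum_sub_distrib]
  refine Finset.sum_congr rfl fun l _ => ?_
  rw [Complex.sq_norm, Complex.sq_norm, Complex.sq_norm, Complex.normSq_sub, ← starRingEnd_apply]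
  simp only [Complex.mul_re, Complex.conj_re, Complex.conj_im]
  ring

lemma trace_rectDiag_mul (d : ℕ → ℂ) (Y : Matrix (Fin m) (Fin n) ℂ) :
    (rectDiag n m d * Y).trace = ∑ i : Fin (min m n),
      d i * Y (i.castLE (min_le_left m n)) (i.castLE (min_le_right m n)) := by
  set f : ℕ → ℂ := fun j => if h : j < m ∧ j < n then d j * Y ⟨j, h.1⟩ ⟨j, h.2⟩ else 0 with hf
  have h1 : ∀ j : Fin n, (rectDiag n m d * Y) j j = f j.val := fun j => by
    rw [Matrix.mul_apply]
    by_cases hj : j.val < m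
    · rw [Finset.sum_eq_single (⟨j.val, hj⟩ : Fin m)]
      · simp [hf, rectDiag_apply, hj]
      · intro x _ hx
        rw [rectDiag_apply, if_neg (fun h => hx (Fin.ext h.symm)), zero_mul]
      · simp
    · rw [Finset.sum_eq_zero]
      · simp [hf, hj]
      · intro x _
        rw [rectDiag_apply, if_neg (by omega), zero_mul]
  rw [Matrix.trace]
  simp only [Matrix.diag_apply, h1]
  rw [← Finset.sum_range f, ← Finset.sum_subset (Finset.range_mono (min_le_right m n)),
    Finset.sum_range]
  · refine Finset.sum_congr rfl fun i _ => ?_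
    have := i.2
    rw [lt_min_iff] at this
    simp only [hf, this.1, this.2, and_self, dif_pos]
    rfl
  · intro i _ hi
    rw [Finset.mem_range, lt_min_iff] at hi
    simp only [hf, hi, dif_neg, not_false_eq_true]

lemma sum_castLE_add_le {q m : ℕ} (h : q ≤ m) {f : Fin m → ℝ} (hf : ∀ i, 0 ≤ f i)
    {i : Fin m} (hi : q ≤ i.val) : f i + ∑ x : Fin q, f (x.castLE h) ≤ ∑ x, f x := by
  have h1 : ∑ x : Fin q, f (x.castLE h) = ∑ x ∈ Finset.univ.map (Fin.castLEEmb h), f x := by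
    rw [Finset.sum_map]; rfl
  have hni : i ∉ Finset.univ.map (Fin.castLEEmb h) := by
    simp only [Finset.mem_map, Finset.mem_univ, true_and, not_exists]
    intro x hx
    have := congrArg Fin.val hx
    simp at this
    omega
  rw [h1, ← Finset.sum_insert hni]
  exact Finset.sum_le_univ_sum_of_nonneg hf

lemma sum_castLE_le {q m : ℕ} (h : q ≤ m) {f : Fin m → ℝ} (hf : ∀ i, 0 ≤ f i) :
    ∑ x : Fin q, f (x.castLE h) ≤ ∑ x, f x := by
  have h1 : ∑ x : Fin q, f (x.castLE h) = ∑ x ∈ Finset.univ.map (Fin.castLEEmb h), f x := by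
    rw [Finset.sum_map]; rfl
  rw [h1]
  exact Finset.sum_le_univ_sum_of_nonneg hf

/-- The equality case of `Re tr(Σ* Y) ≤ s_1 + … + s_k` for partial isometries `Y` of rank `k`. -/
lemma structure_of_re_trace_eq {k : ℕ} (hk : 1 ≤ k) (hkq : k ≤ min m n) {s : ℕ → ℝ}
    (hs : Antitone s) (h0 : ∀ i, 0 ≤ s i) (hsq : ∀ i, min m n ≤ i → s i = 0)
    {Y : Matrix (Fin m) (Fin n) ℂ} (hY : Y * Yᴴ * Y = Y) (htr : (Yᴴ * Y).trace = k)
    (h : (rectDiag n m (fun i => (s i : ℂ)) * Y).trace.re = ∑ i ∈ Finset.range k, s i) :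
    ((∀ (i : Fin m) (j : Fin n), s (k - 1) < s i → Y i j = if i.val = j.val then 1 else 0) ∧
      (∀ (i : Fin m) (j : Fin n), s (k - 1) < s j → Y i j = if i.val = j.val then 1 else 0)) ∧
    ((∀ (i : Fin m) (j : Fin n), s i < s (k - 1) → Y i j = 0) ∧
      (∀ (i : Fin m) (j : Fin n), s j < s (k - 1) → Y i j = 0)) ∧
    (∀ (i : Fin m) (j : Fin n), i.val = j.val → 0 < s i → ∀ l, (Y * Yᴴ) l i = Y l j) := by
  set α : Fin m → ℝ := fun i => ∑ j, ‖Y i j‖ ^ 2 with hα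
  set β : Fin n → ℝ := fun j => ∑ i, ‖Y i j‖ ^ 2 with hβ
  have hα0 : ∀ i, 0 ≤ α i := fun i => Finset.sum_nonneg fun _ _ => sq_nonneg _
  have hβ0 : ∀ i, 0 ≤ β i := fun i => Finset.sum_nonneg fun _ _ => sq_nonneg _
  have hα1 : ∀ i, α i ≤ 1 := row_sum_sq_le_one hY
  have hβ1 : ∀ i, β i ≤ 1 := col_sum_sq_le_one hY
  have hαs : ∑ i, α i = k := by
    rw [Matrix.trace_mul_comm, Matrix.trace] at htr
    simp only [Matrix.diag_apply, mul_conjTranspose_self_apply_self] at htr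
    exact_mod_cast htr
  have hβs : ∑ i, β i = k := by
    rw [← hαs, hβ, hα, Finset.sum_comm]
  let ιm : Fin (min m n) → Fin m := Fin.castLE (min_le_left m n)
  let ιn : Fin (min m n) → Fin n := Fin.castLE (min_le_right m n)
  set d : Fin (min m n) → ℝ := fun i => (α (ιm i) + β (ιn i)) / 2 with hd
  set δ : Fin (min m n) → ℝ := fun i => (∑ l, ‖(Y * Yᴴ) l (ιm i) - Y l (ιn i)‖ ^ 2) / 2 with hδ
  have hdδ : ∀ i, d i - δ i = (Y (ιm i) (ιn i)).re := fun i => by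
    simp only [hd, hδ, sum_sq_range_projection_sub hY, hα, hβ]
    ring
  have hqα : ∑ i, α (ιm i) ≤ k := hαs ▸ sum_castLE_le (min_le_left m n) hα0
  have hqβ : ∑ i, β (ιn i) ≤ k := hβs ▸ sum_castLE_le (min_le_right m n) hβ0
  have hdsum : ∑ i, d i = (∑ i, α (ιm i) + ∑ i, β (ιn i)) / 2 := by
    rw [← Finset.sum_add_distrib, Finset.sum_div]
  have htrace : ∑ i : Fin (min m n), s i * (d i - δ i) = ∑ i ∈ Finset.range k, s i := by
    rw [← h, trace_rectDiag_mul, Complex.re_sum]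
    refine Finset.sum_congr rfl fun i _ => ?_
    rw [hdδ, Complex.re_ofReal_mul]
  obtain ⟨e1, e2, e3, e4⟩ := extremal_weights hk hkq hs h0
    (fun i => by simp only [hd]; linarith [hα0 (ιm i), hβ0 (ιn i)])
    (fun i => by simp only [hd]; linarith [hα1 (ιm i), hβ1 (ιn i)])
    (fun i => div_nonneg (Finset.sum_nonneg fun _ _ => sq_nonneg _) zero_le_two)
    (by rw [hdsum]; linarith) htrace
  have hq : ∀ i, 0 < s i → i < min m n := fun i hi => by
    by_contra hcon
    exact hi.ne' (hsq i (not_lt.1 hcon))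
  have hone : ∀ i : Fin (min m n), s (k - 1) < s i →
      α (ιm i) = 1 ∧ β (ιn i) = 1 ∧ (Y (ιm i) (ιn i)).re = 1 := fun i hi => by
    have h1 := e2 i hi
    have h2 : δ i = 0 := (mul_eq_zero.1 (e1 i)).resolve_left ((h0 (k - 1)).trans_lt hi).ne'
    have h3 := hdδ i
    rw [h1, h2, sub_zero] at h3
    simp only [hd] at h1
    exact ⟨by linarith [hα1 (ιm i), hβ1 (ιn i)], by linarith [hα1 (ιm i), hβ1 (ιn i)], h3.symm⟩
  refine ⟨⟨fun i j hi => ?_, fun i j hj => ?_⟩, ⟨fun i j hi => ?_, fun i j hj => ?_⟩,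
    fun i j hij hi l => ?_⟩
  · obtain ⟨h1, -, h3⟩ := hone ⟨i.val, hq i ((h0 _).trans_lt hi)⟩ hi
    rw [eq_single_of_sum_sq (v := fun j => Y i j) h1 h3 j]
    simp [Fin.ext_iff, ιn, eq_comm]
  · obtain ⟨-, h2, h3⟩ := hone ⟨j.val, hq j ((h0 _).trans_lt hj)⟩ hj
    rw [eq_single_of_sum_sq (v := fun i => Y i j) h2 h3 i]
    simp [Fin.ext_iff, ιm]
  · have hz : α i = 0 := by
      rcases lt_or_ge i.val (min m n) with hiq | hiq
      · have := e3 ⟨i.val, hiq⟩ hi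
        simp only [hd] at this
        have h1 := hβ0 (ιn ⟨i.val, hiq⟩)
        have h2 : 0 ≤ α (ιm ⟨i.val, hiq⟩) := hα0 _
        have h3 : α (ιm ⟨i.val, hiq⟩) = 0 := by linarith
        exact h3
      -- Rows beyond `min m n` are not seen by the weights `d`. But `s_k > 0` forces `∑ d = k`, so
      -- the first `min m n` rows already exhaust the total squared norm `k`.
      · have h1 := e4 ((h0 _).trans_lt hi)
        have h2 := sum_castLE_add_le (min_le_left m n) hα0 hiq
        rw [hαs] at h2
        have h3 : α i + ∑ x, α (ιm x) ≤ k := h2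
        linarith [hα0 i]
    have := (Finset.sum_eq_zero_iff_of_nonneg fun x _ => sq_nonneg ‖Y i x‖).1 hz j
      (Finset.mem_univ j)
    simpa using this
  · have hz : β j = 0 := by
      rcases lt_or_ge j.val (min m n) with hiq | hiq
      · have := e3 ⟨j.val, hiq⟩ hj
        simp only [hd] at this
        have h1 := hα0 (ιm ⟨j.val, hiq⟩)
        have h2 : 0 ≤ β (ιn ⟨j.val, hiq⟩) := hβ0 _
        have h3 : β (ιn ⟨j.val, hiq⟩) = 0 := by linarith
        exact h3
      · have h1 := e4 ((h0 _).trans_lt hj)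
        have h2 := sum_castLE_add_le (min_le_right m n) hβ0 hiq
        rw [hβs] at h2
        have h3 : β j + ∑ x, β (ιn x) ≤ k := h2
        linarith [hβ0 j]
    have := (Finset.sum_eq_zero_iff_of_nonneg fun x _ => sq_nonneg ‖Y x j‖).1 hz i
      (Finset.mem_univ i)
    simpa using this
  · have hiq := hq i hi
    have h1 : δ ⟨i.val, hiq⟩ = 0 := (mul_eq_zero.1 (e1 ⟨i.val, hiq⟩)).resolve_left hi.ne'
    have h2 : ∑ l, ‖(Y * Yᴴ) l (ιm ⟨i.val, hiq⟩) - Y l (ιn ⟨i.val, hiq⟩)‖ ^ 2 = 0 :=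
      (div_eq_zero_iff.1 h1).resolve_right two_ne_zero
    have h3 := (Finset.sum_eq_zero_iff_of_nonneg fun x _ => sq_nonneg _).1 h2 l (Finset.mem_univ l)
    have h4 : ιm ⟨i.val, hiq⟩ = i := rfl
    have h5 : ιn ⟨i.val, hiq⟩ = j := Fin.ext hij
    rw [h4, h5] at h3
    exact sub_eq_zero.1 (norm_eq_zero.1 (pow_eq_zero_iff two_ne_zero |>.1 h3))

end Equality

/-! ### The block of indices with singular value `s_k` -/

section Counting

/-- The indices satisfying a downward closed predicate form an initial segment, so their number is
the cutoff; the shift by one is between indices from `0` and singular values from `1`. -/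
lemma lt_card_filter_iff {q : ℕ} {p : ℕ → Prop} [DecidablePred p]
    (hp : ∀ i j, i ≤ j → p (j + 1) → p (i + 1)) {i : ℕ} (hi : i < q) :
    i < ((Finset.Icc 1 q).filter p).card ↔ p (i + 1) := by
  constructor
  · contrapose!
    intro h
    have hsub : (Finset.Icc 1 q).filter p ⊆ Finset.Icc 1 i := by
      intro j hj
      rw [Finset.mem_filter, Finset.mem_Icc] at hj
      rw [Finset.mem_Icc]
      refine ⟨hj.1.1, ?_⟩
      by_contra hcon
      refine h (hp i (j - 1) (by omega) ?_)
      rw [Nat.sub_add_cancel hj.1.1]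
      exact hj.2
    simpa using Finset.card_le_card hsub
  · intro h
    have hsub : Finset.Icc 1 (i + 1) ⊆ (Finset.Icc 1 q).filter p := by
      intro j hj
      rw [Finset.mem_Icc] at hj
      rw [Finset.mem_filter, Finset.mem_Icc]
      refine ⟨⟨hj.1, by omega⟩, ?_⟩
      have := hp (j - 1) i (by omega) h
      rwa [Nat.sub_add_cancel hj.1] at this
    have := Finset.card_le_card hsub
    simp only [Nat.card_Icc] at this
    omega

variable {m n : ℕ} (F : Matrix (Fin m) (Fin n) ℂ) (k : ℕ)

lemma lt_numGreater_iff {i : ℕ} (hi : i < min m n) :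
    i < numGreater F k ↔ singVal F k < singVal F (i + 1) :=
  lt_card_filter_iff (fun _ _ hij h => h.trans_le (singVal_succ_antitone F hij)) hi

lemma numGreater_add_numEqual :
    numGreater F k + numEqual F k =
      ((Finset.Icc 1 (min m n)).filter fun j => singVal F k ≤ singVal F j).card := by
  rw [numGreater, numEqual, ← Finset.card_union_of_disjoint, ← Finset.filter_or]
  · congr 1
    refine Finset.filter_congr fun j _ => ?_
    rw [le_iff_lt_or_eq, eq_comm (a := singVal F k)]
  · rw [Finset.disjoint_filter]
    intro j _ h1 h2
    exact h1.ne' h2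

lemma lt_numGreater_add_numEqual_iff {i : ℕ} (hi : i < min m n) :
    i < numGreater F k + numEqual F k ↔ singVal F k ≤ singVal F (i + 1) := by
  rw [numGreater_add_numEqual]
  exact lt_card_filter_iff (fun _ _ hij h => h.trans (singVal_succ_antitone F hij)) hi

lemma numGreater_add_numEqual_le : numGreater F k + numEqual F k ≤ min m n := by
  rw [numGreater_add_numEqual]
  refine (Finset.card_filter_le _ _).trans ?_
  simp

variable {k}

lemma numGreater_lt (hk : 1 ≤ k) (hkq : k ≤ min m n) : numGreater F k < k := by
  have h := lt_numGreater_iff F k (i := k - 1) (by omega)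
  rw [Nat.sub_add_cancel hk] at h
  have := mt h.1 (lt_irrefl _)
  omega

lemma le_numGreater_add_numEqual (hk : 1 ≤ k) (hkq : k ≤ min m n) :
    k ≤ numGreater F k + numEqual F k := by
  have h := lt_numGreater_add_numEqual_iff F k (i := k - 1) (by omega)
  rw [Nat.sub_add_cancel hk] at h
  have := h.2 le_rfl
  omega

lemma singVal_succ_eq_of_block {i : ℕ} (h1 : numGreater F k ≤ i)
    (h2 : i < numGreater F k + numEqual F k) : singVal F (i + 1) = singVal F k := by
  have hi := h2.trans_le (numGreater_add_numEqual_le F k)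
  have h3 := (lt_numGreater_add_numEqual_iff F k hi).1 h2
  have h4 := mt (lt_numGreater_iff F k hi).2 (not_lt.2 h1)
  linarith

lemma lt_numGreater_add_numEqual (hkq : k < min m n)
    (h : singVal F k = singVal F (k + 1)) : k < numGreater F k + numEqual F k :=
  (lt_numGreater_add_numEqual_iff F k hkq).2 h.le

lemma numGreater_add_numEqual_eq (hk : 1 ≤ k) (hkq : k ≤ min m n)
    (h : singVal F k ≠ singVal F (k + 1)) : numGreater F k + numEqual F k = k := by
  refine le_antisymm (not_lt.1 fun hlt => h ?_) (le_numGreater_add_numEqual F hk hkq)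
  exact (singVal_succ_eq_of_block F (numGreater_lt F hk hkq).le hlt).symm

end Counting

/-! ### Parametrization of the minimizers -/

section Parametrization

variable {m n : ℕ}

lemma compress_apply {l a b : ℕ} (hm : l + a ≤ m) (hn : l + b ≤ n)
    (Y : Matrix (Fin m) (Fin n) ℂ) (x : Fin a) (y : Fin b) :
    ((incl m l a)ᴴ * Y * incl n l b) x y = Y ⟨l + x.val, by omega⟩ ⟨l + y.val, by omega⟩ := by
  rw [mul_incl_apply hn, conjTranspose_incl_mul_apply hm]

/-- A matrix with the zero pattern of a block diagonal matrix is block diagonal. -/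
lemma eq_blockDiag_compress {l a b : ℕ} (hm : l + a ≤ m) (hn : l + b ≤ n)
    {Y : Matrix (Fin m) (Fin n) ℂ}
    (h1 : ∀ (i : Fin m) (j : Fin n), i.val < l → Y i j = if i.val = j.val then 1 else 0)
    (h2 : ∀ (i : Fin m) (j : Fin n), j.val < l → Y i j = if i.val = j.val then 1 else 0)
    (h3 : ∀ (i : Fin m) (j : Fin n), l + a ≤ i.val → Y i j = 0)
    (h4 : ∀ (i : Fin m) (j : Fin n), l + b ≤ j.val → Y i j = 0) :
    Y = blockDiag m n l ((incl m l a)ᴴ * Y * incl n l b) := by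
  ext i j
  simp only [blockDiag, Matrix.of_apply, compress_apply hm hn]
  split_ifs with h h'
  · congr 1 <;> exact Fin.ext (by simp; omega)
  · rw [h1 i j h'.2, if_pos h'.1]
  · rcases lt_or_ge i.val l with hi | hi
    · rw [h1 i j hi, if_neg (fun e => h' ⟨e, hi⟩)]
    rcases lt_or_ge j.val l with hj | hj
    · rw [h2 i j hj, if_neg (fun e => h' ⟨e, e ▸ hj⟩)]
    rcases lt_or_ge i.val (l + a) with hi' | hi'
    · rcases lt_or_ge j.val (l + b) with hj' | hj'
      · exact absurd ⟨⟨hi, hi'⟩, hj, hj'⟩ h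
      · exact h4 i j hj'
    · exact h3 i j hi'

variable {Φ : Seminorm ℝ (Fin (min m n) → ℝ)} {k : ℕ} {F : Matrix (Fin m) (Fin n) ℂ}
  {V : Matrix (Fin m) (Fin m) ℂ} {W : Matrix (Fin n) (Fin n) ℂ}

lemma eq_conj_of_isSVD (h : IsSVD F V W) (X : Matrix (Fin m) (Fin n) ℂ) :
    X = V * (Vᴴ * X * W) * Wᴴ := by
  simp only [Matrix.mul_assoc]
  rw [unitary_mul_conjTranspose_self h.2.1, Matrix.mul_one, ← Matrix.mul_assoc,
    unitary_mul_conjTranspose_self h.1, Matrix.one_mul]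

/-- The structure of a minimizer in the coordinates of a singular value decomposition. -/
lemma structure_of_mem_minimizers (hΦ : IsSymmetricGauge Φ)
    (hconv : IsStrictlyConvex Φ) (hk : 1 ≤ k) (hkq : k ≤ min m n) (h : IsSVD F V W)
    {X : Matrix (Fin m) (Fin n) ℂ} (hX : X ∈ minimizers Φ k F) :
    ∃ Y ∈ partialIsometries m n k, X = V * Y * Wᴴ ∧
    ((∀ (i : Fin m) (j : Fin n), singVal F k < singVal F (i.val + 1) →
        Y i j = if i.val = j.val then 1 else 0) ∧
      (∀ (i : Fin m) (j : Fin n), singVal F k < singVal F (j.val + 1) →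
        Y i j = if i.val = j.val then 1 else 0)) ∧
    ((∀ (i : Fin m) (j : Fin n), singVal F (i.val + 1) < singVal F k → Y i j = 0) ∧
      (∀ (i : Fin m) (j : Fin n), singVal F (j.val + 1) < singVal F k → Y i j = 0)) ∧
    (∀ (i : Fin m) (j : Fin n), i.val = j.val → 0 < singVal F (i.val + 1) →
      ∀ l, (Y * Yᴴ) l i = Y l j) := by
  set Y := Vᴴ * X * W with hYdef
  have hXY : X = V * Y * Wᴴ := eq_conj_of_isSVD h X
  have hXP := mem_partialIsometries_iff.1 hX.1
  have hY : Y * Yᴴ * Y = Y := by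
    apply unitary_conj_injective h.1 h.2.1
    rw [← unitary_conj_triple h.1 h.2.1, ← hXY, hXP.1]
  have hconj : ∀ A B : Matrix (Fin m) (Fin n) ℂ,
      ((V * A * Wᴴ)ᴴ * (V * B * Wᴴ)).trace = (Aᴴ * B).trace := fun A B => by
    have : (V * A * Wᴴ)ᴴ * (V * B * Wᴴ) = W * (Aᴴ * B) * Wᴴ := by
      simp only [Matrix.conjTranspose_mul, Matrix.conjTranspose_conjTranspose, Matrix.mul_assoc]
      rw [← Matrix.mul_assoc Vᴴ, unitary_conjTranspose_mul_self h.1, Matrix.one_mul]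
    rw [this, trace_unitary_conj h.2.1]
  have htr : (Yᴴ * Y).trace = k := by
    rw [← hconj, ← hXY, hXP.2]
  have hre : (rectDiag n m (fun i => (singVal F (i + 1) : ℂ)) * Y).trace.re =
      ∑ i ∈ Finset.range k, singVal F (i + 1) := by
    have h1 := re_trace_of_mem_minimizers hΦ hconv hkq hX
    have h2 : (sigma F)ᴴ = rectDiag n m fun i => (singVal F (i + 1) : ℂ) := by
      rw [sigma_eq_rectDiag, rectDiag_conjTranspose]
      refine rectDiag_congr fun i _ _ => ?_
      rw [← starRingEnd_apply, Complex.conj_ofReal]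
    rw [← h2, ← hconj, ← hXY, ← h.2.2, h1]
  have key := structure_of_re_trace_eq hk hkq (singVal_succ_antitone F)
    (fun i => singVal_nonneg F _) (fun i hi => singVal_succ_eq_zero_of_le F hi) hY htr hre
  simp only [Nat.sub_add_cancel hk] at key
  exact ⟨Y, mem_partialIsometries_iff.2 ⟨hY, htr⟩, hXY, key⟩

/-- Minimizers of rank `k ≤ rank F`. -/
lemma bijOn_minimizers_of_le_rank (hΦ : IsSymmetricGauge Φ)
    (hconv : IsStrictlyConvex Φ) (hk : 1 ≤ k) (hkr : k ≤ F.rank) (h : IsSVD F V W) :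
    Set.BijOn
      (fun P : Matrix (Fin (numEqual F k)) (Fin (numEqual F k)) ℂ =>
        V * blockDiag m n (numGreater F k) P * Wᴴ)
      {P | IsStarProjection P ∧ P.rank = k - numGreater F k}
      (minimizers Φ k F) := by
  have hkq := hkr.trans (rank_le_min F)
  have hle := numGreater_add_numEqual_le F k
  have hm := hle.trans (min_le_left m n)
  have hn := hle.trans (min_le_right m n)
  have hlk := numGreater_lt F hk hkq
  have hkk : numGreater F k + (k - numGreater F k) = k := by omega
  refine ⟨?_, ?_, ?_⟩
  · rintro P ⟨hP, hPr⟩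
    have := isAligned_projection hm hn h (fun i => singVal_succ_eq_of_block F) hP hPr
    rw [hkk] at this
    exact mem_minimizers_of_isAligned hΦ hconv hkq this
  · intro P _ Q _ hPQ
    exact blockDiag_injective hm hn (unitary_conj_injective h.1 h.2.1 hPQ)
  · intro X hX
    obtain ⟨Y, hYP, hXY, ⟨h1, h2⟩, ⟨h3, h4⟩, h5⟩ :=
      structure_of_mem_minimizers hΦ hconv hk hkq h hX
    have hτ : 0 < singVal F k := by
      have := (singVal_succ_pos_iff F (k - 1)).2 (by omega)
      rwa [Nat.sub_add_cancel hk] at this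
    have hsmall : ∀ i, numGreater F k + numEqual F k ≤ i → singVal F (i + 1) < singVal F k := by
      intro i hi
      rcases lt_or_ge i (min m n) with hiq | hiq
      · exact not_le.1 (mt (lt_numGreater_add_numEqual_iff F k hiq).2 (not_lt.2 hi))
      · rwa [singVal_succ_eq_zero_of_le F hiq]
    have hlarge : ∀ i, i < numGreater F k → singVal F k < singVal F (i + 1) := fun i hi =>
      (lt_numGreater_iff F k (by omega)).1 hi
    set P := (incl m (numGreater F k) (numEqual F k))ᴴ * Y *
      incl n (numGreater F k) (numEqual F k) with hPdef
    have hYb : Y = blockDiag m n (numGreater F k) P :=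
      eq_blockDiag_compress hm hn (fun i j hi => h1 i j (hlarge _ hi))
        (fun i j hj => h2 i j (hlarge _ hj)) (fun i j hi => h3 i j (hsmall _ hi))
        (fun i j hj => h4 i j (hsmall _ hj))
    -- On the block `s_i = s_k > 0`, so the columns of `Y Y*` and `Y` agree there. Compressed to the
    -- block, this is `P P* = P`.
    have hP : IsStarProjection P := by
      rw [isStarProjection_iff_of_matrix, ← compress_blockDiag hm hm (P * Pᴴ),
        ← blockDiag_mul hn, ← blockDiag_conjTranspose, ← hYb]
      ext x y
      rw [compress_apply hm hm, hPdef, compress_apply hm hn]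
      refine h5 _ _ rfl ?_ _
      rw [singVal_succ_eq_of_block F (k := k) (by simp) (by simp)]
      exact hτ
    refine ⟨P, ⟨hP, ?_⟩, ?_⟩
    · rw [← mem_partialIsometries_of_isStarProjection hP,
        ← blockDiag_mem_partialIsometries_iff hm hn, ← hYb, hkk]
      exact hYP
    · simp only
      rw [← hYb, ← hXY]

/-- Minimizers of rank `k > rank F`. -/
lemma bijOn_minimizers_of_rank_lt (hΦ : IsSymmetricGauge Φ)
    (hconv : IsStrictlyConvex Φ) {r : ℕ} (hr : F.rank = r) (hrk : r < k) (hkq : k ≤ min m n)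
    (h : IsSVD F V W) :
    Set.BijOn
      (fun S : Matrix (Fin (m - r)) (Fin (n - r)) ℂ => V * blockDiag m n r S * Wᴴ)
      (partialIsometries (m - r) (n - r) (k - r)) (minimizers Φ k F) := by
  have hm : r + (m - r) ≤ m := by omega
  have hn : r + (n - r) ≤ n := by omega
  have hkk : r + (k - r) = k := by omega
  refine ⟨?_, ?_, ?_⟩
  · intro S hS
    have := isAligned_partialIsometry hm hn hr h hS
    rw [hkk] at this
    exact mem_minimizers_of_isAligned hΦ hconv hkq this
  · intro P _ Q _ hPQ
    exact blockDiag_injective hm hn (unitary_conj_injective h.1 h.2.1 hPQ)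
  · intro X hX
    obtain ⟨Y, hYP, hXY, ⟨h1, h2⟩, -, -⟩ :=
      structure_of_mem_minimizers hΦ hconv (by omega) hkq h hX
    -- Here `s_k = 0`, so the indices with `s_i > s_k` are exactly the first `r`, and no condition
    -- beyond being a partial isometry is left on the other block.
    have hlarge : ∀ i, i < r → singVal F k < singVal F (i + 1) := fun i hi => by
      have := (singVal_succ_eq_zero_iff F (k - 1)).2 (by omega)
      rw [Nat.sub_add_cancel (by omega)] at this
      rw [this]
      exact (singVal_succ_pos_iff F i).2 (hr ▸ hi)
    have hYb := eq_blockDiag_compress hm hn (fun i j hi => h1 i j (hlarge _ hi))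
        (fun i j hj => h2 i j (hlarge _ hj)) (fun i j hi => absurd i.2 (by omega))
        (fun i j hj => absurd j.2 (by omega))
    refine ⟨(incl m r (m - r))ᴴ * Y * incl n r (n - r), ?_, ?_⟩
    · rw [← blockDiag_mem_partialIsometries_iff hm hn, ← hYb, hkk]
      exact hYP
    · simp only
      rw [← hYb, ← hXY]

end Parametrization

/-! ### Infinite families of projections and partial isometries -/

section Infinite

/-- The points have arguments `1 / (t + 1)` in `(0, 1]`, inside the principal branch, so
`Complex.arg` separates them. -/
lemma infinite_unit_complex : {z : ℂ | star z * z = 1}.Infinite := by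
  refine Set.infinite_of_injective_forall_mem
    (f := fun t : ℕ => (Circle.exp (1 / ((t : ℝ) + 1)) : ℂ)) ?_ ?_
  · intro t u htu
    have harg : ∀ t : ℕ, Complex.arg (Circle.exp (1 / ((t : ℝ) + 1)) : ℂ) = 1 / ((t : ℝ) + 1) := by
      intro t
      have h1 : 0 < 1 / ((t : ℝ) + 1) := by positivity
      have h2 : 1 / ((t : ℝ) + 1) ≤ 1 := by
        rw [div_le_one (by positivity)]
        linarith [Nat.cast_nonneg (α := ℝ) t]
      exact Circle.arg_exp (by linarith [Real.pi_pos]) (by linarith [Real.pi_gt_three])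
    have h3 := congrArg Complex.arg htu
    simp only [harg] at h3
    have h4 : (t : ℝ) + 1 = u + 1 := by
      have := congrArg (fun x : ℝ => x⁻¹) h3
      simpa using this
    exact_mod_cast add_right_cancel h4
  · intro t
    change star (Circle.exp (1 / ((t : ℝ) + 1)) : ℂ) * (Circle.exp (1 / ((t : ℝ) + 1)) : ℂ) = 1
    rw [← starRingEnd_apply, Complex.conj_mul', Circle.norm_coe]
    simp

lemma infinite_partialIsometries {a b p : ℕ} (hp : 1 ≤ p) (hpa : p ≤ min a b) :
    (partialIsometries a b p).Infinite := by
  have hmem : ∀ z : ℂ, star z * z = 1 → z • leadingOnes a b p ∈ partialIsometries a b p := by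
    intro z hz
    have h1 := leadingOnes_mem hpa (one_mem (Matrix.unitaryGroup (Fin a) ℂ))
      (one_mem (Matrix.unitaryGroup (Fin b) ℂ))
    rw [Matrix.conjTranspose_one, Matrix.one_mul, Matrix.mul_one, mem_partialIsometries_iff] at h1
    have hz' : z * star z = 1 := by rw [mul_comm, hz]
    rw [mem_partialIsometries_iff]
    simp only [Matrix.conjTranspose_smul, Matrix.smul_mul, Matrix.mul_smul, smul_smul,
      hz, one_smul, h1, hz', and_self]
  refine (infinite_unit_complex.image (f := fun z => z • leadingOnes a b p) ?_).mono ?_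
  · intro z _ w _ hzw
    have := congrFun (congrFun hzw ⟨0, by omega⟩) ⟨0, by omega⟩
    simpa [leadingOnes, rectDiag_apply, show 0 < p by omega] using this
  · rintro _ ⟨z, hz, rfl⟩
    exact hmem z hz

lemma infinite_projections {e p : ℕ} (hp : 1 ≤ p) (hpe : p < e) :
    {P : Matrix (Fin e) (Fin e) ℂ | IsStarProjection P ∧ P.rank = p}.Infinite := by
  let x : Fin e := ⟨p - 1, by omega⟩
  let y : Fin e := ⟨p, hpe⟩
  have hxy : x ≠ y := fun h => by
    have := congrArg Fin.val h
    simp only [x, y] at this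
    omega
  -- The coefficients `3/5` and `4/5` make `v z` a unit vector for `|z| = 1` and keep both
  -- coordinates nonzero, so `z` can be read off the off-diagonal entry of `v v*`. Adding `v v*` to
  -- a fixed projection of rank `p - 1` orthogonal to `v` gives rank `p`.
  let v : ℂ → Fin e → ℂ := fun z i => if i = x then 3 / 5 else if i = y then 4 / 5 * z else 0
  let Q : Matrix (Fin e) (Fin e) ℂ := leadingOnes e e (p - 1)
  have hQH : Qᴴ = Q := leadingOnes_conjTranspose _
  have hQQ : Q * Q = Q := leadingOnes_mul_leadingOnes (by omega)
  have hQd : Q = Matrix.diagonal fun i : Fin e => if i.val < p - 1 then 1 else 0 := by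
    simp only [Q, leadingOnes, rectDiag_self]
  have hQv : ∀ z, Q *ᵥ v z = 0 := fun z => by
    ext i
    rw [hQd, Matrix.mulVec_diagonal]
    by_cases hi : i.val < p - 1
    · have h1 : i ≠ x := fun h => by simp [h, x] at hi
      have h2 : i ≠ y := fun h => by simp [h, y] at hi; omega
      simp [v, h1, h2]
    · simp [hi]
  have hvQ : ∀ z, star (v z) ᵥ* Q = 0 := fun z => by
    rw [← hQH, ← Matrix.star_mulVec, hQv, star_zero]
  have hvv : ∀ z, star z * z = 1 → star (v z) ⬝ᵥ v z = 1 := fun z hz => by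
    rw [dotProduct, Finset.sum_eq_add x y hxy]
    · have hz' : (starRingEnd ℂ) z * z = 1 := hz
      simp only [Pi.star_apply, v, if_true, if_neg hxy.symm, ← starRingEnd_apply, map_mul,
        map_div₀, map_ofNat]
      linear_combination (16 / 25 : ℂ) * hz'
    · intro i _ hi
      simp [v, hi.1, hi.2]
    · simp
    · simp
  let P : ℂ → Matrix (Fin e) (Fin e) ℂ := fun z => Q + Matrix.vecMulVec (v z) (star (v z))
  have hP : ∀ z, star z * z = 1 → IsStarProjection (P z) ∧ (P z).rank = p := by
    intro z hz
    have h1 : IsStarProjection (P z) := by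
      rw [isStarProjection_iff_of_matrix]
      have hvec : Matrix.vecMulVec (v z) (star (v z)) * Matrix.vecMulVec (v z) (star (v z)) =
          Matrix.vecMulVec (v z) (star (v z)) := by
        rw [Matrix.vecMulVec_mul_vecMulVec, hvv z hz, one_smul]
      simp only [P, Matrix.conjTranspose_add, hQH, Matrix.conjTranspose_vecMulVec, star_star]
      rw [Matrix.add_mul, Matrix.mul_add, Matrix.mul_add, hQQ, hvec, Matrix.mul_vecMulVec,
        Matrix.vecMulVec_mul, hQv, hvQ]
      simp
    refine ⟨h1, (rank_eq_iff_trace_of_isStarProjection h1).2 ?_⟩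
    simp only [P, Matrix.trace_add, Matrix.trace_vecMulVec, Q]
    rw [trace_leadingOnes (by omega), dotProduct_comm, hvv z hz]
    rw [Nat.cast_sub hp, Nat.cast_one, sub_add_cancel]
  refine (infinite_unit_complex.image (f := P) ?_).mono ?_
  · intro z _ w _ hzw
    have h1 := congrFun (congrFun hzw y) x
    simp only [P, Matrix.add_apply, Matrix.vecMulVec_apply, add_right_inj] at h1
    simpa [v, hxy.symm] using h1
  · rintro _ ⟨z, hz, rfl⟩
    exact hP z hz

end Infinite

/-! ### The canonical polar decomposition in SVD coordinates -/

section Polar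

variable {m n : ℕ} {F : Matrix (Fin m) (Fin n) ℂ}
  {V : Matrix (Fin m) (Fin m) ℂ} {W : Matrix (Fin n) (Fin n) ℂ}

open scoped MatrixOrder ComplexOrder in
lemma matAbs_of_isSVD (h : IsSVD F V W) :
    matAbs F = W * rectDiag n n (fun i => (singVal F (i + 1) : ℂ)) * Wᴴ := by
  refine CFC.sqrt_unique ?_ (Matrix.nonneg_iff_posSemidef.2 ?_)
  · have hF : F = V * rectDiag m n (fun i => (singVal F (i + 1) : ℂ)) * Wᴴ := h.2.2
    rw [conjTranspose_mul_self_of_eq h.1 hF]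
    simp only [Matrix.mul_assoc]
    rw [← Matrix.mul_assoc Wᴴ, unitary_conjTranspose_mul_self h.2.1, Matrix.one_mul,
      ← Matrix.mul_assoc (rectDiag n n _), rectDiag_mul]
    congr 2
    refine rectDiag_congr fun i hi _ => ?_
    rw [if_pos hi]
    split_ifs with him
    · rw [Complex.norm_real, Real.norm_eq_abs, sq_abs, sq, Complex.ofReal_mul]
    · rw [singVal_succ_eq_zero_of_le F (by omega)]
      simp
  · refine Matrix.PosSemidef.mul_mul_conjTranspose_same ?_ W
    rw [rectDiag_self, Matrix.posSemidef_diagonal_iff]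
    intro i
    exact_mod_cast singVal_nonneg F _

lemma ker_le_of_eq_mul {A : Matrix (Fin m) (Fin m) ℂ} {B C : Matrix (Fin m) (Fin n) ℂ}
    (h : C = A * B) :
    LinearMap.ker (Matrix.toEuclideanLin B) ≤ LinearMap.ker (Matrix.toEuclideanLin C) := by
  rw [h, Matrix.toEuclideanLin, Matrix.toLpLin_mul_same]
  exact LinearMap.ker_le_ker_comp _ _

lemma mul_eq_zero_of_ker_le {B C : Matrix (Fin m) (Fin n) ℂ}
    (h : LinearMap.ker (Matrix.toEuclideanLin B) ≤ LinearMap.ker (Matrix.toEuclideanLin C))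
    {p : ℕ} {Z : Matrix (Fin n) (Fin p) ℂ} (hZ : B * Z = 0) : C * Z = 0 := by
  ext i j
  have h1 : Matrix.toEuclideanLin B (WithLp.toLp 2 (Z.col j)) = 0 := by
    ext i
    exact congrFun (congrFun hZ i) j
  have h2 := LinearMap.mem_ker.1 (h (LinearMap.mem_ker.2 h1))
  exact congrArg (fun u : EuclideanSpace ℂ (Fin m) => u i) h2

/-- The isometric factor of the canonical polar decomposition in terms of a singular value
decomposition. -/
lemma isCanonicalPolar_iff (h : IsSVD F V W) (U : Matrix (Fin m) (Fin n) ℂ) :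
    IsCanonicalPolar F U ↔ U = V * leadingOnes m n F.rank * Wᴴ := by
  have hF : F = V * rectDiag m n (fun i => (singVal F (i + 1) : ℂ)) * Wᴴ := h.2.2
  generalize hρ : F.rank = ρ
  set s : ℕ → ℂ := fun i => (singVal F (i + 1) : ℂ) with hs
  have hs0 : ∀ i, ¬ i < ρ → s i = 0 := fun i hi => by
    simp [hs, (singVal_succ_eq_zero_iff F i).2 (hρ ▸ not_lt.1 hi)]
  have hs1 : ∀ i, i < ρ → s i ≠ 0 := fun i hi => by
    simp only [hs]
    exact_mod_cast ((singVal_succ_pos_iff F i).2 (hρ ▸ hi)).ne'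
  have hWW := unitary_conjTranspose_mul_self h.2.1
  have hVV := unitary_conjTranspose_mul_self h.1
  constructor
  · rintro ⟨-, hker, hU⟩
    rw [matAbs_of_isSVD h] at hU
    -- The equation `F = U |F|` determines `U W` only on the first `ρ` coordinates. The kernel
    -- condition makes it vanish on the others, because `F W` does.
    have h1 : F * (W * (1 - leadingOnes n n ρ)) = 0 := by
      rw [hF, Matrix.mul_assoc, ← Matrix.mul_assoc Wᴴ, hWW, Matrix.one_mul, Matrix.mul_assoc,
        leadingOnes, ← rectDiag_one, rectDiag_sub, rectDiag_mul]
      have : rectDiag m n (fun i => if i < n then s i * (1 - if i < ρ then 1 else 0) else 0)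
          = 0 := by
        rw [← rectDiag_zero]
        refine rectDiag_congr fun i _ _ => ?_
        by_cases hi : i < ρ
        · simp [hi]
        · simp [hs0 i hi]
      rw [this, Matrix.mul_zero]
    have h2 := mul_eq_zero_of_ker_le hker.ge h1
    rw [← Matrix.mul_assoc, Matrix.mul_sub, Matrix.mul_one, sub_eq_zero] at h2
    have h3 : U * W * rectDiag n n s = V * rectDiag m n s := by
      have : F * W = U * (W * rectDiag n n s * Wᴴ) * W := by rw [← hU]
      rw [hF] at this
      simp only [Matrix.mul_assoc, hWW, Matrix.mul_one] at this
      rw [Matrix.mul_assoc, this]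
    -- Inverting the nonzero singular values gives a pseudo-inverse of `Σ`, which cancels `Σ` on the
    -- first `ρ` coordinates.
    have h4 : ∀ p, rectDiag p n s * rectDiag n n (fun i => (s i)⁻¹) = leadingOnes p n ρ := by
      intro p
      rw [rectDiag_mul, leadingOnes]
      refine rectDiag_congr fun i _ hi' => ?_
      by_cases hi : i < ρ
      · simp [hi, hi', mul_inv_cancel₀ (hs1 i hi)]
      · simp [hi, hs0 i hi]
    have h5 : U * W = V * leadingOnes m n ρ := by
      rw [h2, ← h4, ← Matrix.mul_assoc, h3, Matrix.mul_assoc, h4]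
    rw [← h5, Matrix.mul_assoc, unitary_mul_conjTranspose_self h.2.1, Matrix.mul_one]
  · intro hU
    have hmul : ∀ d d' : ℕ → ℂ, V * rectDiag m m d * Vᴴ * (V * rectDiag m n d' * Wᴴ) =
        V * rectDiag m n (fun i => if i < m then d i * d' i else 0) * Wᴴ := by
      intro d d'
      rw [← rectDiag_mul]
      simp only [Matrix.mul_assoc]
      rw [← Matrix.mul_assoc Vᴴ, hVV, Matrix.one_mul]
    refine ⟨?_, le_antisymm ?_ ?_, ?_⟩
    · rw [hU]
      exact (leadingOnes_mem (hρ ▸ rank_le_min F) h.1 h.2.1).1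
    · refine ker_le_of_eq_mul (A := V * rectDiag m m s * Vᴴ) ?_
      rw [hU, leadingOnes, hmul]
      conv_lhs => rw [hF]
      congr 2
      refine rectDiag_congr fun i hi _ => ?_
      by_cases hir : i < ρ
      · simp [hi, hir]
      · simp [hs0 i hir]
    · refine ker_le_of_eq_mul (A := V * rectDiag m m (fun i => (s i)⁻¹) * Vᴴ) ?_
      conv_rhs => rw [hF]
      rw [hU, leadingOnes, hmul]
      congr 2
      refine rectDiag_congr fun i hi _ => ?_
      by_cases hir : i < ρ
      · simp [hi, hir, inv_mul_cancel₀ (hs1 i hir)]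
      · simp [hir, hs0 i hir]
    · rw [matAbs_of_isSVD h, hU]
      have : V * leadingOnes m n ρ * Wᴴ * (W * rectDiag n n s * Wᴴ) =
          V * (leadingOnes m n ρ * rectDiag n n s) * Wᴴ := by
        simp only [Matrix.mul_assoc]
        rw [← Matrix.mul_assoc Wᴴ, hWW, Matrix.one_mul]
      rw [this, leadingOnes, rectDiag_mul]
      conv_lhs => rw [hF]
      congr 2
      refine rectDiag_congr fun i hi hin => ?_
      by_cases hir : i < ρ
      · simp [hin, hir]
      · simp [hs0 i hir]

end Polar

/-! ### Uniqueness and infinitude of minimizers -/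

section Unique

variable {m n : ℕ} {Φ : Seminorm ℝ (Fin (min m n) → ℝ)} {k : ℕ} {F : Matrix (Fin m) (Fin n) ℂ}

/-- A gap after `s_k` gives `ℓ_k + e_k = k`, so the parametrizing projection has full rank `e_k` and
can only be the identity. -/
lemma minimizers_subsingleton (hΦ : IsSymmetricGauge Φ)
    (hconv : IsStrictlyConvex Φ) (hk : 1 ≤ k) (hkr : k ≤ F.rank)
    (h : singVal F k ≠ singVal F (k + 1)) : (minimizers Φ k F).Subsingleton := by
  obtain ⟨V, W, hs⟩ := exists_isSVD F
  have hlk := numGreater_add_numEqual_eq F hk (hkr.trans (rank_le_min F)) h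
  rw [← (bijOn_minimizers_of_le_rank hΦ hconv hk hkr hs).image_eq]
  refine Set.Subsingleton.image ?_ _
  have hone : ∀ P : Matrix (Fin (numEqual F k)) (Fin (numEqual F k)) ℂ,
      IsStarProjection P ∧ P.rank = k - numGreater F k → P = 1 := by
    rintro P ⟨hP, hPr⟩
    obtain ⟨Q, hQ, hPQ⟩ := exists_diagonalization_of_isStarProjection hP
    have h1 : leadingOnes (numEqual F k) (numEqual F k) P.rank = 1 := by
      rw [← rectDiag_one, leadingOnes]
      exact rectDiag_congr fun i hi _ => if_pos (by omega)
    rw [hPQ, h1, Matrix.mul_one, unitary_mul_conjTranspose_self hQ]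
  intro P hP P' hP'
  rw [hone P hP, hone P' hP']

lemma minimizers_nonempty (hΦ : IsSymmetricGauge Φ)
    (hconv : IsStrictlyConvex Φ) (hkq : k ≤ min m n) : (minimizers Φ k F).Nonempty := by
  obtain ⟨V, W, hs⟩ := exists_isSVD F
  exact ⟨_, mem_minimizers_of_isAligned hΦ hconv hkq ⟨V, W, hs, rfl⟩⟩

lemma minimizers_infinite_of_singVal_eq (hΦ : IsSymmetricGauge Φ)
    (hconv : IsStrictlyConvex Φ) (hk : 1 ≤ k) (hkr : k < F.rank)
    (h : singVal F k = singVal F (k + 1)) : (minimizers Φ k F).Infinite := by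
  obtain ⟨V, W, hs⟩ := exists_isSVD F
  have hbij := bijOn_minimizers_of_le_rank hΦ hconv hk hkr.le hs
  have hkq := hkr.trans_le (rank_le_min F)
  have h1 := numGreater_lt F hk hkq.le
  have h2 := lt_numGreater_add_numEqual F hkq h
  rw [← hbij.image_eq]
  exact (infinite_projections (by omega) (by omega)).image hbij.injOn

lemma minimizers_infinite_of_rank_lt (hΦ : IsSymmetricGauge Φ)
    (hconv : IsStrictlyConvex Φ) (hrk : F.rank < k) (hkq : k ≤ min m n) :
    (minimizers Φ k F).Infinite := by
  obtain ⟨V, W, hs⟩ := exists_isSVD F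
  have hbij := bijOn_minimizers_of_rank_lt hΦ hconv rfl hrk hkq hs
  rw [← hbij.image_eq]
  exact (infinite_partialIsometries (by omega) (by omega)).image hbij.injOn

end Unique

end PartialIsometryApprox

end

theorem mainTheorem3 (m n k r : ℕ) (hk : 1 ≤ k) (hkq : k ≤ min m n)
    (F : Matrix (Fin m) (Fin n) ℂ) (hF : F.rank = r)
    (Φ : Seminorm ℝ (Fin (min m n) → ℝ))
    (hΦ : PartialIsometryApprox.IsSymmetricGauge Φ)
    (hconv : PartialIsometryApprox.IsStrictlyConvex Φ) :
    (k < r →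
      ((∃! X, X ∈ PartialIsometryApprox.minimizers Φ k F) ↔
        PartialIsometryApprox.singVal F k ≠ PartialIsometryApprox.singVal F (k + 1)) ∧
      (PartialIsometryApprox.singVal F k = PartialIsometryApprox.singVal F (k + 1) →
        (PartialIsometryApprox.minimizers Φ k F).Infinite ∧
        ∀ V W, PartialIsometryApprox.IsSVD F V W →
          Set.BijOn
            (fun P : Matrix (Fin (PartialIsometryApprox.numEqual F k))
                (Fin (PartialIsometryApprox.numEqual F k)) ℂ =>
              V * PartialIsometryApprox.blockDiag m n
                (PartialIsometryApprox.numGreater F k) P * Wᴴ)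
            {P | IsStarProjection P ∧ P.rank = k - PartialIsometryApprox.numGreater F k}
            (PartialIsometryApprox.minimizers Φ k F))) ∧
    (k = r →
      (∃ U, PartialIsometryApprox.IsCanonicalPolar F U) ∧
      ∀ U, PartialIsometryApprox.IsCanonicalPolar F U →
        PartialIsometryApprox.minimizers Φ k F = {U}) ∧
    (r < k →
      (PartialIsometryApprox.minimizers Φ k F).Infinite ∧
      ∀ V W, PartialIsometryApprox.IsSVD F V W →
        Set.BijOn
          (fun S : Matrix (Fin (m - r)) (Fin (n - r)) ℂ =>
            V * PartialIsometryApprox.blockDiag m n r S * Wᴴ)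
          (PartialIsometryApprox.partialIsometries (m - r) (n - r) (k - r))
          (PartialIsometryApprox.minimizers Φ k F)) := by
  open PartialIsometryApprox in
  refine ⟨fun hkr => ⟨⟨?_, ?_⟩, fun h => ⟨?_, fun V W hs => ?_⟩⟩, fun hkr => ⟨?_, fun U hU => ?_⟩,
    fun hrk => ⟨?_, fun V W hs => ?_⟩⟩
  · rintro ⟨X, hX, huniq⟩ h
    refine minimizers_infinite_of_singVal_eq hΦ hconv hk (hF ▸ hkr) h
      ((Set.finite_singleton X).subset fun Y hY => huniq Y hY)
  · intro h
    obtain ⟨X, hX⟩ := minimizers_nonempty (F := F) hΦ hconv hkq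
    exact ⟨X, hX, fun Y hY => minimizers_subsingleton hΦ hconv hk (hF ▸ hkr.le) h hY hX⟩
  · exact minimizers_infinite_of_singVal_eq hΦ hconv hk (hF ▸ hkr) h
  · exact bijOn_minimizers_of_le_rank hΦ hconv hk (hF ▸ hkr.le) hs
  · obtain ⟨V, W, hs⟩ := exists_isSVD F
    exact ⟨_, (isCanonicalPolar_iff hs _).2 rfl⟩
  · obtain ⟨V, W, hs⟩ := exists_isSVD F
    -- For `k = r` one has `s_k > 0 = s_{k+1}`; if also `k = min m n`, then `s_{k+1}` is the default
    -- value `0` beyond the range, and the argument is the same.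
    have hne : singVal F k ≠ singVal F (k + 1) := by
      have h1 := (singVal_succ_pos_iff F (k - 1)).2 (by omega)
      rw [Nat.sub_add_cancel hk] at h1
      rw [(singVal_succ_eq_zero_iff F k).2 (by omega)]
      exact h1.ne'
    have hUm : U ∈ minimizers Φ k F := by
      rw [(isCanonicalPolar_iff hs U).1 hU, hF, ← hkr]
      exact mem_minimizers_of_isAligned hΦ hconv hkq ⟨V, W, hs, rfl⟩
    exact (minimizers_subsingleton hΦ hconv hk (by omega) hne).eq_singleton_of_mem hUm
  · exact minimizers_infinite_of_rank_lt hΦ hconv (hF ▸ hrk) hkq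
  · exact bijOn_minimizers_of_rank_lt hΦ hconv hF hrk hkq hs
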